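/- Let $n,l,g$ be natural numbers with $g\ge 3$. A finite connected simple graph is unicyclic if it has as many edges as vertices; it then has exactly one cycle $u_1u_2\cdots u_g$, and it is obtained from this cycle by attaching trees $T_1,\dots,T_g$ at the roots $u_1,\dots,u_g$. Let $\mathcal U_{n,l}^{g,1}$ be the set of unicyclic graphs with $n$ vertices, exactly $l$ leaves (vertices of degree one) and girth $g$ for which, for a suitable labelling of the cycle, $|V(T_i)|=1$ for $i=2,\dots,g$. For $q\ge 0$ with $n-g-q\ge l\ge 1$ let $U^q=U_{n,l}^{g,q}$ be the graph of order $n$ obtained from a cycle of order $g$ by identifying one of its vertices with one end of a path on $q+1$ vertices and attaching to the other end of this path (to the cycle vertex itself if $q=0$) $l$ pendant paths, each with $\lfloor (n-g-q)/l\rfloor$ or $\lceil (n-g-q)/l\rceil$ new vertices, $n-g-q$ new vertices in total. If $l=0$, so that $n=g$, let $U^0$ be the cycle of order $n$. For a graph $G$ of order $n$ with Laplacian matrix $D(G)-A(G)$ and Laplacian eigenvalues $\mu_1\ge\dots\ge\mu_n=0$, let $LEL(G)=\sum_{k=1}^{n-1}\sqrt{\mu_k}$. Then for every $G\in\mathcal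 U_{n,l}^{g,1}$, $$LEL(G)\ \ge\ \min\{LEL(U^0),LEL(U^1),\dots,LEL(U^p)\},\qquad p=\max\Big\{0,\Big\lfloor\frac{n-g-gl+l}{l+1}\Big\rfloor\Big\}.$$ -/

import Mathlib

namespace UnicyclicLEL

open Classical in
/-- The Laplacian-like energy of a finite simple graph: the sum of the square roots of the
eigenvalues, with multiplicity, of the Laplacian matrix `D - A`. (The smallest eigenvalue is `0`,
so it makes no difference whether it is included in the sum.) -/
noncomputable def LEL {V : Type*} [Fintype V] (G : SimpleGraph V) : ℝ :=
  ∑ i : V, Real.sqrt ((SimpleGraph.isHermitian_lapMatrix (R := ℝ) G).eigenvalues i)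

open Classical in
/-- The number of leaves, i.e. of vertices of degree one. -/
noncomputable def numLeaves {V : Type*} [Fintype V] (G : SimpleGraph V) : ℕ :=
  (Finset.univ.filter fun v : V => G.degree v = 1).card

/-- A finite graph is unicyclic if it is connected and has as many edges as vertices. -/
def IsUnicyclic {V : Type*} [Fintype V] (G : SimpleGraph V) : Prop :=
  G.Connected ∧ G.edgeSet.ncard = Fintype.card V

/-- The vertex set of the tree attached at the vertex `w` of the cycle `c`: the component of `w`
after the edges of `c` are deleted. -/
def attachedTree {V : Type*} (G : SimpleGraph V) {u : V} (c : G.Walk u u) (w : V) : Set V :=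
  {x | (G.deleteEdges {e | e ∈ c.edges}).Reachable w x}

/-- The class of unicyclic graphs with `n` vertices, `l` leaves and girth `g`, obtained from a cycle
`u₁ … u_g` by attaching trees `T₁, …, T_g` at `u₁, …, u_g`, of which `T₂, …, T_g` consist
of a single vertex. -/
structure SingleTreeClass {V : Type*} [Fintype V] (n l g : ℕ) (G : SimpleGraph V) : Prop where
  unicyclic : IsUnicyclic G
  order : Fintype.card V = n
  leaves : numLeaves G = l
  girth : G.egirth = (g : ℕ∞)
  single_tree : ∃ (u₁ : V) (c : G.Walk u₁ u₁), c.IsCycle ∧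
    ∀ w ∈ c.support, w ≠ u₁ → (attachedTree G c w).ncard = 1

/-- If `N` vertices (other than the centre) are divided among `l` legs as evenly as possible, the
`i`-th leg gets `⌊N / l⌋` or `⌈N / l⌉` of them. -/
def legLength (N l : ℕ) (i : Fin l) : ℕ :=
  N / l + if i.val < N % l then 1 else 0

/-- The vertices of the balanced starlike unicyclic graph: the cycle `u₁, …, u_g` (indexed from
`0`), the path vertices `w₁, …, w_p` (indexed from `0`), and the vertices of the `l` legs. -/
inductive BalVertex (n l g p : ℕ) : Type
  | cyc (i : Fin g) : BalVertex n l g p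
  | path (j : Fin p) : BalVertex n l g p
  | leg (a : Fin l) (k : Fin (legLength (n - g - p) l a)) : BalVertex n l g p

/-- The vertices as a disjoint union. -/
def BalVertex.equivSum (n l g p : ℕ) :
    BalVertex n l g p ≃ Fin g ⊕ Fin p ⊕ (Σ a : Fin l, Fin (legLength (n - g - p) l a)) where
  toFun
    | .cyc i => .inl i
    | .path j => .inr (.inl j)
    | .leg a k => .inr (.inr ⟨a, k⟩)
  invFun
    | .inl i => .cyc i
    | .inr (.inl j) => .path j
    | .inr (.inr ⟨a, k⟩) => .leg a k
  left_inv := by rintro (_ | _ | _) <;> rfl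
  right_inv := by rintro (_ | _ | ⟨_, _⟩) <;> rfl

instance (n l g p : ℕ) : Fintype (BalVertex n l g p) :=
  Fintype.ofEquiv _ (BalVertex.equivSum n l g p).symm

/-- The edges of the balanced starlike unicyclic graph, each in at least one orientation. The path
`u₁ w₁ … w_p` has `p + 1` vertices; its last vertex, which is `u₁` if `p = 0` and `w_p` otherwise,
is the centre, to which the first vertex of every leg is joined. -/
def balRel (n l g p : ℕ) : BalVertex n l g p → BalVertex n l g p → Prop
  | .cyc i, .cyc i' => (SimpleGraph.cycleGraph g).Adj i i'
  | .cyc i, .path j => i.val = 0 ∧ j.val = 0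
  | .path j, .path j' => j.val + 1 = j'.val
  | .cyc i, .leg _ k => p = 0 ∧ i.val = 0 ∧ k.val = 0
  | .path j, .leg _ k => j.val + 1 = p ∧ k.val = 0
  | .leg a k, .leg a' k' => a = a' ∧ k.val + 1 = k'.val
  | _, _ => False

/-- The balanced starlike unicyclic graph `U_{n,l}^{g,p}` of order `n` with `l` leaves and girth
`g`: one end of a path on `p + 1` vertices is identified with a vertex of a cycle of order `g`, and
its other end with the centre of the balanced starlike tree of order `n - p - g + 1` with `l` leaves
(`l` paths, with `⌊(n - g - p) / l⌋ + 1` or `⌈(n - g - p) / l⌉ + 1` vertices each, identified at one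
end). It is meaningful for `g ≥ 3` and `n ≥ g + p + l`; for `l = 0`, `n = g` and `p = 0` it is the
cycle. -/
def balancedStarlikeUnicyclic (n l g p : ℕ) : SimpleGraph (BalVertex n l g p) :=
  SimpleGraph.fromRel (balRel n l g p)

/-- `max {0, ⌊(n - g - gl + l) / (l + 1)⌋}`. -/
def maxPathLength (n l g : ℕ) : ℕ :=
  (⌊((n : ℚ) - g - g * l + l) / (l + 1)⌋).toNat

end UnicyclicLEL

/-! Since log (1 + μ / t²) has integral π√μ over the positive half-line, π times the Laplacian-like
energy is the integral of log det (t² + L) - n log t². For graphs of equal order it is therefore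
enough to compare det (t + L) for every t > 0 (`LEL_le`).

Read t + L as a network of unit resistors, each vertex being grounded through a conductance t. With
an extra conductance x at a root the determinant is affine in x, namely a (t + x) + b: here a is the
determinant with the root removed, and b / a is the conductance from the root to the ground through
the other vertices. Identifying roots multiplies the a's and adds the conductances, which is
multiplication of the dual numbers a + b ε; `up` adds an edge in series.

The engine is `gdet_slide`: sliding a load along a path to the end with the larger remaining
conductance does not increase the determinant. It merges two brooms hung at one root into one, so by
induction the attached tree may be replaced by a starlike tree with as many edges and leaves
(`RootedTree.dominates`); it balances the legs (`star_balance`); and it shortens the path of the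
broom (`exists_short_broom`).

Of the cycle one needs only that it conducts at least as well as a path with g - 1 edges, which is
Rayleigh monotonicity (`Describes.add_edge`). A path of length q can be shortened while some leg has
fewer than q + g - 1 edges. If it stops at q > 0, then l (q + g - 1) + q ≤ n - g, that is, q ≤ p. -/

namespace UnicyclicLEL
open TrivSqZeroExt

/-! ### Rooted networks as dual numbers

A rooted graph whose grounded Laplacian (ground conductance `t` at every vertex, extra conductance
`x` at the root) has determinant `a * (t + x) + b` is recorded by the dual number `a + b ε`.
Identifying roots becomes multiplication. -/

/-- Hanging a rooted network from a new root by an edge. -/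
noncomputable def up (t : ℝ) (a : DualNumber ℝ) : DualNumber ℝ :=
  inl ((1 + t) * a.fst + a.snd) + inr (t * a.fst + a.snd)

@[simp] lemma fst_up (t : ℝ) (a : DualNumber ℝ) : (up t a).fst = (1 + t) * a.fst + a.snd := by
  simp [up]

@[simp] lemma snd_up (t : ℝ) (a : DualNumber ℝ) : (up t a).snd = t * a.fst + a.snd := by
  simp [up]

/-- The determinant of the grounded Laplacian without extra conductance at the root. -/
noncomputable def gdet (t : ℝ) (a : DualNumber ℝ) : ℝ := t * a.fst + a.snd

/-- Nonnegative conductances. -/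
def Nonneg (a : DualNumber ℝ) : Prop := 0 ≤ a.fst ∧ 0 ≤ a.snd

/-- Comparison of the determinants for all nonnegative extra conductances at the root. -/
def Below (t : ℝ) (a b : DualNumber ℝ) : Prop := a.fst ≤ b.fst ∧ gdet t a ≤ gdet t b

/-- The sign of the difference of the conductances of two rooted networks. -/
noncomputable def cross (a b : DualNumber ℝ) : ℝ := a.snd * b.fst - a.fst * b.snd

lemma Nonneg.one : Nonneg 1 := by simp [Nonneg]

lemma Nonneg.mul {a b : DualNumber ℝ} (ha : Nonneg a) (hb : Nonneg b) : Nonneg (a * b) := by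
  obtain ⟨h1, h2⟩ := ha
  obtain ⟨h3, h4⟩ := hb
  constructor
  · simp; positivity
  · simp; positivity

lemma Nonneg.up {t : ℝ} (ht : 0 < t) {a : DualNumber ℝ} (ha : Nonneg a) : Nonneg (up t a) := by
  obtain ⟨h1, h2⟩ := ha
  constructor
  · simp; positivity
  · simp; positivity

lemma Nonneg.iterate_up {t : ℝ} (ht : 0 < t) {a : DualNumber ℝ} (ha : Nonneg a) (d : ℕ) :
    Nonneg ((UnicyclicLEL.up t)^[d] a) := by
  induction d with
  | zero => exact ha
  | succ d ih => rw [Function.iterate_succ_apply']; exact ih.up ht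

lemma Below.refl (t : ℝ) (a : DualNumber ℝ) : Below t a a := ⟨le_rfl, le_rfl⟩

lemma Below.trans {t : ℝ} {a b c : DualNumber ℝ} (h : Below t a b) (h' : Below t b c) :
    Below t a c := ⟨h.1.trans h'.1, h.2.trans h'.2⟩

lemma Below.mul_left {t : ℝ} {a b c : DualNumber ℝ} (h : Below t a b) (hc : Nonneg c) :
    Below t (c * a) (c * b) := by
  obtain ⟨h1, h2⟩ := h
  obtain ⟨h3, h4⟩ := hc
  simp only [gdet] at h2
  constructor
  · simp; gcongr
  · simp [gdet]; nlinarith [mul_le_mul_of_nonneg_left h1 h4, mul_le_mul_of_nonneg_left h2 h3]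

lemma Below.mul_right {t : ℝ} {a b c : DualNumber ℝ} (h : Below t a b) (hc : Nonneg c) :
    Below t (a * c) (b * c) := by
  rw [mul_comm a, mul_comm b]; exact h.mul_left hc

lemma Below.mul {t : ℝ} {a b c d : DualNumber ℝ} (h : Below t a b) (h' : Below t c d)
    (hb : Nonneg b) (hc : Nonneg c) : Below t (a * c) (b * d) :=
  (h.mul_right hc).trans (h'.mul_left hb)

lemma Below.up {t : ℝ} (ht : 0 < t) {a b : DualNumber ℝ} (h : Below t a b) :
    Below t (up t a) (up t b) := by
  obtain ⟨h1, h2⟩ := h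
  simp only [gdet] at h2
  constructor
  · simp; linarith
  · simp [gdet]; nlinarith

/-- To compare two networks it is enough to compare them with every load at the root. -/
lemma Below.of_forall_gdet {t : ℝ} {a b : DualNumber ℝ}
    (h : ∀ c : DualNumber ℝ, Nonneg c → gdet t (c * a) ≤ gdet t (c * b)) : Below t a b := by
  constructor
  · simpa [gdet] using h (inr 1) (by simp [Nonneg])
  · simpa using h 1 Nonneg.one

/-- Both sides are the determinant of `a` and `b` with their roots joined by an edge; only the end
taken as the root differs. -/
lemma gdet_up_mul (t : ℝ) (a b : DualNumber ℝ) : gdet t (up t a * b) = gdet t (a * up t b) := by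
  simp [gdet]; ring

lemma gdet_iterate_up_mul (t : ℝ) (a b : DualNumber ℝ) (d : ℕ) :
    gdet t ((up t)^[d] a * b) = gdet t (a * (up t)^[d] b) := by
  induction d generalizing b with
  | zero => rfl
  | succ d ih => rw [Function.iterate_succ_apply', gdet_up_mul, ih, Function.iterate_succ_apply]

/-- `up t` is linear in the two components, so its iterates are determined by their values on `1`
and on `inr 1`, a root short-circuited to the ground. -/
lemma iterate_up_eq (t : ℝ) (a : DualNumber ℝ) (d : ℕ) :
    ((up t)^[d] a).fst = a.fst * ((up t)^[d] 1).fst + a.snd * ((up t)^[d] (inr 1)).fst ∧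
    ((up t)^[d] a).snd = a.fst * ((up t)^[d] 1).snd + a.snd * ((up t)^[d] (inr 1)).snd := by
  induction d with
  | zero => simp
  | succ d ih =>
    simp only [Function.iterate_succ_apply', fst_up, snd_up, ih.1, ih.2]
    constructor <;> ring

/-- Moving a load `Y` along a path of length `d` from `E` to `Z` does not increase the determinant
if the conductance at `Z` is at least that at `E`. -/
lemma gdet_slide {t : ℝ} (ht : 0 < t) {Z Y E : DualNumber ℝ} (hY : Nonneg Y)
    (h : 0 ≤ cross Z E) (d : ℕ) :
    gdet t (Z * Y * (up t)^[d] E) ≤ gdet t (Z * (up t)^[d] (E * Y)) := by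
  -- Reversing the path relates the entries of its transfer matrix. After this substitution the two
  -- sides of the goal differ by exactly `Y.snd * ((up t)^[d] (inr 1)).fst * cross Z E`.
  have hs := gdet_iterate_up_mul t 1 (inr 1) d
  have hu := (Nonneg.iterate_up ht (a := inr 1) (by simp [Nonneg]) d).1
  simp only [gdet, fst_mul, snd_mul, (iterate_up_eq t E d).1, (iterate_up_eq t E d).2,
    (iterate_up_eq t (E * Y) d).1, (iterate_up_eq t (E * Y) d).2]
  generalize (up t)^[d] (inr 1) = x at *
  generalize (up t)^[d] 1 = y at *
  simp [gdet] at hs ⊢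
  simp only [cross] at h
  rw [hs]
  have := mul_nonneg (mul_nonneg hY.2 hu) h
  linear_combination this

/-- On pairs, `up t` acts by the matrix with rows (1 + t, 1) and (t, 1), which has determinant 1,
and `cross` is up to sign the determinant of two pairs. -/
lemma cross_up (t : ℝ) (a b : DualNumber ℝ) : cross (up t a) (up t b) = cross a b := by
  simp [cross]; ring

lemma cross_iterate_up (t : ℝ) (a b : DualNumber ℝ) (d : ℕ) :
    cross ((up t)^[d] a) ((up t)^[d] b) = cross a b := by
  induction d with
  | zero => rfl
  | succ d ih => rw [Function.iterate_succ_apply', Function.iterate_succ_apply', cross_up, ih]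

/-- A network in parallel can only add conductance. -/
lemma cross_mul_nonneg {a b c : DualNumber ℝ} (ha : Nonneg a) (hb : Nonneg b) (hc : Nonneg c)
    (h : 0 ≤ cross a c) : 0 ≤ cross (a * b) c := by
  have h1 := mul_nonneg hb.1 h
  have h2 := mul_nonneg (mul_nonneg ha.1 hb.2) hc.1
  simp [cross] at h1 ⊢
  linear_combination h1 + h2

lemma cross_trans {a b c : DualNumber ℝ} (ha : Nonneg a) (hb : 0 < b.fst) (hc : Nonneg c)
    (h : 0 ≤ cross a b) (h' : 0 ≤ cross b c) : 0 ≤ cross a c := by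
  have h1 := mul_nonneg hc.1 h
  have h2 := mul_nonneg ha.1 h'
  refine nonneg_of_mul_nonneg_right (a := b.fst) ?_ hb
  simp only [cross] at h1 h2 ⊢
  linear_combination h1 + h2

/-! ### Paths, stars and brooms -/

/-- A path with `i` edges rooted at one of its ends. -/
noncomputable def pathNet (t : ℝ) (i : ℕ) : DualNumber ℝ := (up t)^[i] 1

lemma pathNet_succ (t : ℝ) (i : ℕ) : pathNet t (i + 1) = up t (pathNet t i) :=
  Function.iterate_succ_apply' ..

lemma iterate_up_pathNet (t : ℝ) (d i : ℕ) : (up t)^[d] (pathNet t i) = pathNet t (d + i) :=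
  (Function.iterate_add_apply ..).symm

lemma pathNet_nonneg {t : ℝ} (ht : 0 < t) (i : ℕ) : Nonneg (pathNet t i) := Nonneg.one.iterate_up ht i

lemma pathNet_fst_pos {t : ℝ} (ht : 0 < t) (i : ℕ) : 0 < (pathNet t i).fst := by
  induction i with
  | zero => simp [pathNet]
  | succ i ih =>
    rw [pathNet_succ, fst_up]
    have := (pathNet_nonneg ht i).2
    positivity

/-- Stripping `j` edges from both paths leaves a path against a bare root, which has conductance
zero. -/
lemma cross_pathNet {t : ℝ} (ht : 0 < t) {i j : ℕ} (h : j ≤ i) : 0 ≤ cross (pathNet t i) (pathNet t j) := by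
  obtain ⟨k, rfl⟩ := Nat.exists_eq_add_of_le h
  rw [← iterate_up_pathNet, pathNet, pathNet, ← Function.iterate_add_apply, Nat.add_comm j k,
    Nat.add_comm, Function.iterate_add_apply, ← pathNet, cross_iterate_up]
  · simpa [cross] using (pathNet_nonneg ht k).2

/-- Legs of the given lengths with a common root. -/
noncomputable def star (t : ℝ) (s : Multiset ℕ) : DualNumber ℝ := (s.map (pathNet t)).prod

@[simp] lemma star_zero (t : ℝ) : star t 0 = 1 := by simp [star]

@[simp] lemma star_cons (t : ℝ) (a : ℕ) (s : Multiset ℕ) :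
    star t (a ::ₘ s) = pathNet t a * star t s := by simp [star]

@[simp] lemma star_add (t : ℝ) (s s' : Multiset ℕ) :
    star t (s + s') = star t s * star t s' := by simp [star]

lemma star_nonneg {t : ℝ} (ht : 0 < t) (s : Multiset ℕ) : Nonneg (star t s) := by
  induction s using Multiset.induction with
  | empty => simpa using Nonneg.one
  | cons a s ih => simpa using (pathNet_nonneg ht a).mul ih

lemma cross_star {t : ℝ} (ht : 0 < t) {s : Multiset ℕ} {i j : ℕ} (hi : i ∈ s) (h : j ≤ i) :
    0 ≤ cross (star t s) (pathNet t j) := by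
  obtain ⟨s, rfl⟩ := Multiset.exists_cons_of_mem hi
  rw [star_cons]
  exact cross_mul_nonneg (pathNet_nonneg ht i) (star_nonneg ht s) (pathNet_nonneg ht j) (cross_pathNet ht h)

/-- A starlike tree whose centre is joined to the root by a path of length `q`. -/
noncomputable def broom (t : ℝ) (q : ℕ) (s : Multiset ℕ) : DualNumber ℝ := (up t)^[q] (star t s)

lemma broom_nonneg {t : ℝ} (ht : 0 < t) (q : ℕ) (s : Multiset ℕ) : Nonneg (broom t q s) :=
  (star_nonneg ht s).iterate_up ht q

/-- Pulling all legs but one of a broom to the root. -/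
lemma pull_broom {t : ℝ} (ht : 0 < t) {Z : DualNumber ℝ} (hZ : Nonneg Z) {j : ℕ}
    (h : 0 ≤ cross Z (pathNet t j)) (d : ℕ) (s : Multiset ℕ) :
    Below t (Z * star t ((d + j) ::ₘ s)) (Z * broom t d (j ::ₘ s)) := by
  refine Below.of_forall_gdet fun c hc => ?_
  rw [broom, star_cons, star_cons, ← iterate_up_pathNet, ← mul_assoc, ← mul_assoc, ← mul_assoc,
    mul_right_comm]
  refine gdet_slide ht (star_nonneg ht s) ?_ d
  rw [mul_comm]
  exact cross_mul_nonneg hZ hc (pathNet_nonneg ht j) h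

/-- Pushing all legs but a short one from the root to the centre of a broom. -/
lemma push_star {t : ℝ} (ht : 0 < t) {i j : ℕ} (hij : i ≤ j) (d : ℕ) {s s' : Multiset ℕ}
    (hj : j ∈ s') :
    Below t (star t (s' + (d + i) ::ₘ s)) (star t (i ::ₘ s) * broom t d s') := by
  refine Below.of_forall_gdet fun c hc => ?_
  -- The outer load `c` slides together with `s`, so the root of the smaller network is the former
  -- centre of the broom, and the path prolongs the short leg `i`.
  have := gdet_slide ht (Z := star t s') (Y := c * star t s) (E := pathNet t i)
    (hc.mul (star_nonneg ht s)) (cross_star ht hj hij) d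
  rw [iterate_up_pathNet, ← gdet_iterate_up_mul] at this
  convert this using 2
  · simp only [star_add, star_cons]; ring
  · simp only [star_cons, broom]; ring

/-! ### Merging starlike trees hung at one root -/

/-- A valid description of a starlike tree: legs are not empty, and without legs there is no
path. -/
def Valid (q : ℕ) (s : Multiset ℕ) : Prop := (∀ i ∈ s, 1 ≤ i) ∧ (s = 0 → q = 0)

/-- The starlike tree `(q, s)` is no larger than `a`, has `m` edges and `l` legs. -/
def Dominates (a : ℝ → DualNumber ℝ) (m l : ℕ) : Prop :=
  ∃ (q : ℕ) (s : Multiset ℕ), Valid q s ∧ s.card = l ∧ q + s.sum = m ∧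
    ∀ t, 0 < t → Below t (broom t q s) (a t)

lemma Dominates.of_star {a : ℝ → DualNumber ℝ} (s : Multiset ℕ) (hs : ∀ i ∈ s, 1 ≤ i)
    {m l : ℕ} (hm : s.sum = m) (hl : s.card = l)
    (h : ∀ t, 0 < t → Below t (star t s) (a t)) : Dominates a m l :=
  ⟨0, s, ⟨hs, fun _ => rfl⟩, hl, by simpa using hm, h⟩

/-- The load slides in one direction or the other according to which side has the shorter leg. If
both sides have legs, the path of the broom is absorbed into one leg and a star remains. -/
lemma Dominates.star_mul_broom {q : ℕ} {s s' : Multiset ℕ} (hs : ∀ i ∈ s, 1 ≤ i)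
    (hs' : Valid q s') :
    Dominates (fun t => star t s * broom t q s') (s.sum + (q + s'.sum)) (s.card + s'.card) := by
  rcases s'.empty_or_exists_mem with rfl | ⟨j₀, hj₀⟩
  · obtain rfl := hs'.2 rfl
    exact .of_star s hs (by simp) (by simp) fun t _ => by simp [broom, Below.refl]
  rcases s.empty_or_exists_mem with rfl | ⟨i, hi⟩
  · exact ⟨q, s', hs', by simp, by simp, fun t _ => by simp [Below.refl]⟩
  by_cases h : ∃ j ∈ s', j ≤ i
  · obtain ⟨j, hj, hji⟩ := h
    obtain ⟨s', rfl⟩ := Multiset.exists_cons_of_mem hj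
    refine .of_star (s + (q + j) ::ₘ s') ?_ (by simp; ring) (by simp; ring) fun t ht => ?_
    · have h1 := hs'.1
      simp only [Multiset.mem_add, Multiset.mem_cons] at h1 ⊢
      rintro k (hk | rfl | hk)
      · exact hs k hk
      · have := h1 j (.inl rfl); omega
      · exact h1 k (.inr hk)
    · rw [star_add]
      exact pull_broom ht (star_nonneg ht s) (cross_star ht hi hji) q s'
  · push Not at h
    obtain ⟨s, rfl⟩ := Multiset.exists_cons_of_mem hi
    refine .of_star (s' + (q + i) ::ₘ s) ?_ (by simp; ring) (by simp; ring) fun t ht => ?_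
    · simp only [Multiset.mem_add, Multiset.mem_cons] at hs ⊢
      rintro k (hk | rfl | hk)
      · exact hs'.1 k hk
      · have := hs i (.inl rfl); omega
      · exact hs k (.inr hk)
    · exact push_star ht (h j₀ hj₀).le q hj₀

lemma Dominates.mono {a b : ℝ → DualNumber ℝ} {m l : ℕ} (h : Dominates a m l)
    (hab : ∀ t, 0 < t → Below t (a t) (b t)) : Dominates b m l := by
  obtain ⟨q, s, h1, h2, h3, h4⟩ := h
  exact ⟨q, s, h1, h2, h3, fun t ht => (h4 t ht).trans (hab t ht)⟩

/-- Compare with a path of `q + j` edges in between: the first `q` edges are common and drop out. -/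
lemma cross_broom {t : ℝ} (ht : 0 < t) {s : Multiset ℕ} {i j : ℕ} (hi : i ∈ s) (h : j ≤ i)
    (q : ℕ) : 0 ≤ cross (broom t q s) (pathNet t j) := by
  refine cross_trans (b := pathNet t (q + j)) (broom_nonneg ht q s) (pathNet_fst_pos ht _)
    (pathNet_nonneg ht j) ?_ (cross_pathNet ht (by omega))
  rw [broom, ← iterate_up_pathNet, cross_iterate_up]
  exact cross_star ht hi h

/-- The second broom conducts at least like its leg `i`, so every leg of the first one except `j`
can be pulled to the common root. This turns the first broom into a star. -/
lemma Dominates.pull {q q' i j : ℕ} {s s' : Multiset ℕ} (hs : Valid q (j ::ₘ s))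
    (hs' : Valid q' s') (hi : i ∈ s') (hij : j ≤ i) :
    Dominates (fun t => broom t q (j ::ₘ s) * broom t q' s')
      (q + (j ::ₘ s).sum + (q' + s'.sum)) ((j ::ₘ s).card + s'.card) := by
  have h := Dominates.star_mul_broom (q := q') (s := (q + j) ::ₘ s) (s' := s') ?_ hs'
  · have h' := h.mono (b := fun t => broom t q (j ::ₘ s) * broom t q' s') fun t ht => ?_
    · convert h' using 1 <;> simp; ring
    · rw [mul_comm, mul_comm (broom t q _)]
      exact pull_broom ht (broom_nonneg ht q' s') (cross_broom ht hi hij q') q s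
  · have h1 := hs.1
    simp only [Multiset.mem_cons] at h1 ⊢
    rintro k (rfl | hk)
    · have := h1 j (.inl rfl); omega
    · exact h1 k (.inr hk)

/-- Given one leg of each broom, the broom with the shorter of the two is the one to be pulled
apart. -/
lemma Dominates.broom_mul_broom {q q' : ℕ} {s s' : Multiset ℕ} (hs : Valid q s)
    (hs' : Valid q' s') :
    Dominates (fun t => broom t q s * broom t q' s')
      (q + s.sum + (q' + s'.sum)) (s.card + s'.card) := by
  rcases s'.empty_or_exists_mem with rfl | ⟨i, hi⟩
  · obtain rfl := hs'.2 rfl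
    exact ⟨q, s, hs, by simp, by simp, fun t _ => by simp [broom, Below.refl]⟩
  rcases s.empty_or_exists_mem with rfl | ⟨j, hj⟩
  · obtain rfl := hs.2 rfl
    exact ⟨q', s', hs', by simp, by simp, fun t _ => by simp [broom, Below.refl]⟩
  rcases le_total j i with h | h
  · obtain ⟨s, rfl⟩ := Multiset.exists_cons_of_mem hj
    exact .pull hs hs' hi h
  · obtain ⟨s', rfl⟩ := Multiset.exists_cons_of_mem hi
    convert Dominates.pull hs' hs hj h using 1
    · ext1 t; rw [mul_comm]
    · ring
    · ring

/-! ### Reducing rooted trees to starlike trees -/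

/-- Rooted trees, built by joining the root of one to the root of another by an edge. -/
inductive RootedTree : Type
  | pt : RootedTree
  | join (a b : RootedTree) : RootedTree

namespace RootedTree

/-- The number of edges. -/
def edges : RootedTree → ℕ
  | pt => 0
  | join a b => a.edges + b.edges + 1

/-- The number of leaves other than the root. -/
def leaves : RootedTree → ℕ
  | pt => 0
  | join a b => a.leaves + if b.edges = 0 then 1 else b.leaves

/-- The network of a rooted tree. -/
noncomputable def network (t : ℝ) : RootedTree → DualNumber ℝ
  | pt => 1
  | join a b => a.network t * up t (b.network t)

lemma network_nonneg {t : ℝ} (ht : 0 < t) (a : RootedTree) : Nonneg (a.network t) := by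
  induction a with
  | pt => exact Nonneg.one
  | join a b iha ihb => exact iha.mul (ihb.up ht)

lemma eq_pt_of_edges {a : RootedTree} (h : a.edges = 0) : a = pt := by
  cases a
  · rfl
  · simp [edges] at h

/-- Every rooted tree is at least some starlike tree with as many edges and leaves. -/
theorem dominates (a : RootedTree) : Dominates (fun t => a.network t) a.edges a.leaves := by
  induction a with
  | pt => exact .of_star 0 (by simp) rfl rfl fun t _ => by simp [network, Below.refl]
  | join a b iha ihb =>
    have hb : Dominates (fun t => up t (b.network t)) (b.edges + 1)
        (if b.edges = 0 then 1 else b.leaves) := by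
      split_ifs with h
      · obtain rfl := eq_pt_of_edges h
        exact .of_star {1} (by simp) rfl rfl fun t _ => by
          simp [star, network, pathNet, Below.refl]
      · obtain ⟨q, s, h1, h2, h3, h4⟩ := ihb
        refine ⟨q + 1, s, ⟨h1.1, fun hs => ?_⟩, h2, by omega, fun t ht => ?_⟩
        · have := h1.2 hs
          subst hs this
          exact absurd h3.symm h
        · rw [broom, Function.iterate_succ_apply']
          exact (h4 t ht).up ht
    obtain ⟨q, s, h1, h2, h3, h4⟩ := iha
    obtain ⟨q', s', h1', h2', h3', h4'⟩ := hb
    have := (Dominates.broom_mul_broom h1 h1').mono fun t ht =>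
      (h4 t ht).mul (h4' t ht) (a.network_nonneg ht) (broom_nonneg ht q' s')
    simp only [network, edges, leaves]
    convert this using 1 <;> omega

end RootedTree

/-! ### Balancing the legs -/

/-- Legs `i` and `j + 1` form one path on which everything else is a load; on the smaller side this
load sits one vertex nearer the middle. -/
lemma star_balance {t : ℝ} (ht : 0 < t) {i j : ℕ} (h : j ≤ i) (s : Multiset ℕ) :
    Below t (star t ((j + 1) ::ₘ i ::ₘ s)) (star t (j ::ₘ (i + 1) ::ₘ s)) := by
  refine Below.of_forall_gdet fun c hc => ?_
  have := gdet_slide ht (Z := pathNet t i) (Y := c * star t s) (E := pathNet t j)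
    (hc.mul (star_nonneg ht s)) (cross_pathNet ht h) 1
  rw [Function.iterate_one, ← pathNet_succ, ← gdet_up_mul, ← pathNet_succ] at this
  convert this using 2
  · simp only [star_cons]; ring
  · simp only [star_cons]; ring

/-- Moving one edge from a leg to another that is shorter by at least two strictly decreases the sum
of the squares of the lengths. -/
lemma exists_balanced (s : Multiset ℕ) (hs : ∀ i ∈ s, 1 ≤ i) :
    ∃ s' : Multiset ℕ, s'.card = s.card ∧ s'.sum = s.sum ∧ (∀ i ∈ s', ∀ j ∈ s', i ≤ j + 1) ∧
      ∀ t, 0 < t → Below t (star t s') (star t s) := by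
  induction hN : (s.map (· ^ 2)).sum using Nat.strong_induction_on generalizing s with
  | _ N ih =>
  by_cases h : ∀ i ∈ s, ∀ j ∈ s, i ≤ j + 1
  · exact ⟨s, rfl, rfl, h, fun t _ => .refl t _⟩
  push Not at h
  obtain ⟨i, hi, j, hj, hij⟩ := h
  obtain ⟨s, rfl⟩ := Multiset.exists_cons_of_mem hj
  obtain ⟨s, rfl⟩ := Multiset.exists_cons_of_mem
    ((Multiset.mem_cons.1 hi).resolve_left (by omega))
  obtain ⟨k, rfl⟩ : ∃ k, i = k + 1 := ⟨i - 1, by omega⟩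
  have hlt : ((((j + 1) ::ₘ k ::ₘ s)).map (· ^ 2)).sum < N := by
    rw [← hN]
    simp only [Multiset.map_cons, Multiset.sum_cons]
    nlinarith
  have hpos : ∀ m ∈ (j + 1) ::ₘ k ::ₘ s, 1 ≤ m := by
    simp only [Multiset.mem_cons] at hs ⊢
    rintro m (rfl | rfl | hm)
    · omega
    · have := hs j (.inl rfl); omega
    · exact hs m (.inr (.inr hm))
  obtain ⟨s', h1, h2, h3, h4⟩ := ih _ hlt _ hpos rfl
  refine ⟨s', by simpa using h1, ?_, h3, fun t ht => (h4 t ht).trans ?_⟩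
  · simpa [add_assoc, add_left_comm, add_comm] using h2
  · exact star_balance ht (by omega) s

/-- Every entry is the minimum `m` or `m + 1`, and `m` occurs, so `m` and the number of entries `m +
1` are the quotient and the remainder of the sum by the cardinality. -/
lemma eq_replicate_of_balanced {s : Multiset ℕ} (h : ∀ i ∈ s, ∀ j ∈ s, i ≤ j + 1)
    (hs : s ≠ 0) :
    s = Multiset.replicate (s.card - s.sum % s.card) (s.sum / s.card) +
      Multiset.replicate (s.sum % s.card) (s.sum / s.card + 1) := by
  obtain ⟨m, hm, hmin⟩ : ∃ m ∈ s, ∀ i ∈ s, m ≤ i := by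
    obtain ⟨m, hm, h'⟩ := s.toFinset.exists_min_image id
      (by simpa [Finset.nonempty_iff_ne_empty] using hs)
    exact ⟨m, by simpa using hm, fun i hi => h' i (by simpa using hi)⟩
  have hs1 : s.filter (· = m) + s.filter (¬ · = m) = s := Multiset.filter_add_not _ s
  have h1 : s.filter (· = m) = Multiset.replicate (s.count m) m := Multiset.filter_eq' s m
  have h2 : s.filter (¬ · = m) = Multiset.replicate (s.card - s.count m) (m + 1) := by
    rw [Multiset.eq_replicate]
    constructor
    · have := congrArg Multiset.card hs1
      rw [Multiset.card_add, h1, Multiset.card_replicate] at this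
      omega
    · intro b hb
      rw [Multiset.mem_filter] at hb
      have := hmin b hb.1
      have := h b hb.1 m hm
      omega
  have hc := Multiset.count_le_card m s
  have hp : 0 < s.count m := Multiset.count_pos.2 hm
  rw [h1, h2] at hs1
  have h3 : s.sum = m * s.card + (s.card - s.count m) := by
    conv_lhs => rw [← hs1]
    obtain ⟨k, hk⟩ := Nat.exists_eq_add_of_le hc
    simp only [Multiset.sum_add, Multiset.sum_replicate, smul_eq_mul, hk]
    rw [Nat.add_sub_cancel_left]; ring
  have h4 : s.sum / s.card = m := by
    rw [h3]
    refine Nat.div_eq_of_lt_le ?_ ?_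
    · omega
    · rw [add_mul, mul_comm m]; omega
  have h5 : s.sum % s.card = s.card - s.count m := by
    have := Nat.div_add_mod s.sum s.card
    rw [h4, mul_comm] at this; omega
  rw [h4, h5, Nat.sub_sub_self hc]
  exact hs1.symm

/-- The multiset of the lengths of balanced legs. -/
def balancedLegs (N l : ℕ) : Multiset ℕ := (Finset.univ : Finset (Fin l)).val.map (legLength N l)

lemma sum_ite_lt {l b : ℕ} (h : b ≤ l) :
    ((Finset.univ : Finset (Fin l)).val.map fun i => if i.val < b then 1 else 0).sum = b := by
  change ∑ i : Fin l, (if i.val < b then 1 else 0) = b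
  rw [Fin.sum_univ_eq_sum_range (fun i => if i < b then 1 else 0), ← Finset.sum_filter,
    Finset.sum_const, smul_eq_mul, mul_one]
  have : (Finset.range l).filter (· < b) = Finset.range b := by ext; simp; omega
  simp [this]

lemma card_balancedLegs (N l : ℕ) : (balancedLegs N l).card = l := by simp [balancedLegs]

lemma sum_balancedLegs {N l : ℕ} (hl : 0 < l) : (balancedLegs N l).sum = N := by
  unfold balancedLegs legLength
  rw [Multiset.sum_map_add, sum_ite_lt (Nat.mod_lt N hl).le, Multiset.map_const',
    Multiset.sum_replicate]
  simp [Nat.div_add_mod]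

lemma eq_balancedLegs {s : Multiset ℕ} (h : ∀ i ∈ s, ∀ j ∈ s, i ≤ j + 1) :
    s = balancedLegs s.sum s.card := by
  rcases eq_or_ne s 0 with rfl | hs
  · exact (Multiset.card_eq_zero.1 (card_balancedLegs _ _)).symm
  have hpos : 0 < s.card := Multiset.card_pos.2 hs
  have h' : ∀ i ∈ balancedLegs s.sum s.card, ∀ j ∈ balancedLegs s.sum s.card, i ≤ j + 1 := by
    simp only [balancedLegs, Multiset.mem_map, legLength]
    rintro _ ⟨i, -, rfl⟩ _ ⟨j, -, rfl⟩
    split_ifs <;> omega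
  have h1 := eq_replicate_of_balanced h' (by
    rw [← Multiset.card_pos, card_balancedLegs]; exact hpos)
  rw [card_balancedLegs, sum_balancedLegs hpos] at h1
  rw [h1]
  exact eq_replicate_of_balanced h hs

/-! ### Shortening the path -/

lemma below_balancedLegs (s : Multiset ℕ) (hs : ∀ i ∈ s, 1 ≤ i) {t : ℝ} (ht : 0 < t) :
    Below t (star t (balancedLegs s.sum s.card)) (star t s) := by
  obtain ⟨s', h1, h2, h3, h4⟩ := exists_balanced s hs
  rw [← h1, ← h2, ← eq_balancedLegs h3]
  exact h4 t ht

/-- Seen from the centre, `c` and the path form a single load on the star. -/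
lemma gdet_mul_broom_balancedLegs {t : ℝ} (ht : 0 < t) {c : DualNumber ℝ} (hc : Nonneg c)
    {s : Multiset ℕ} (hs : ∀ i ∈ s, 1 ≤ i) (q : ℕ) :
    gdet t (c * broom t q (balancedLegs s.sum s.card)) ≤ gdet t (c * broom t q s) := by
  rw [broom, ← gdet_iterate_up_mul, broom, ← gdet_iterate_up_mul]
  exact ((below_balancedLegs s hs ht).mul_left (hc.iterate_up ht q)).2

/-- Among the starlike trees hanging from a network which conducts better than a path with `k`
edges, those with a short path and balanced legs are the smallest. -/
theorem exists_short_broom (k q : ℕ) (s : Multiset ℕ) (hs : Valid q s)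
    {c : ℝ → DualNumber ℝ} (hc : ∀ t, 0 < t → Nonneg (c t))
    (hk : ∀ t, 0 < t → 0 ≤ cross (c t) (pathNet t k)) :
    ∃ q', q' + s.card ≤ q + s.sum ∧ (q' = 0 ∨ s.card * (q' + k) + q' ≤ q + s.sum) ∧
      (s.card = 0 → q' = 0) ∧
      ∀ t, 0 < t → gdet t (c t * broom t q' (balancedLegs (q + s.sum - q') s.card))
        ≤ gdet t (c t * broom t q s) := by
  have hcard : s.card ≤ s.sum := by
    simpa using Multiset.card_nsmul_le_sum (a := 1) hs.1
  have key : ∀ t, 0 < t → gdet t (c t * broom t q (balancedLegs (q + s.sum - q) s.card))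
      ≤ gdet t (c t * broom t q s) := by
    intro t ht
    rw [Nat.add_sub_cancel_left]
    exact gdet_mul_broom_balancedLegs ht (hc t ht) hs.1 q
  induction q generalizing s with
  | zero => exact ⟨0, by simpa using hcard, .inl rfl, fun _ => rfl, key⟩
  | succ q ih =>
    -- If all legs are this long, summing their lengths gives the required bound. Otherwise the last
    -- edge of the path is transferred to a short leg.
    by_cases h : ∀ i ∈ s, q + 1 + k ≤ i
    · have := Multiset.card_nsmul_le_sum h
      rw [smul_eq_mul] at this
      exact ⟨q + 1, by omega, .inr (by omega), fun h0 => hs.2 (Multiset.card_eq_zero.1 h0), key⟩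
    push Not at h
    obtain ⟨j, hj, hjk⟩ := h
    obtain ⟨s, rfl⟩ := Multiset.exists_cons_of_mem hj
    have hs' : Valid q ((j + 1) ::ₘ s) := by
      refine ⟨?_, by simp⟩
      have h1 := hs.1
      simp only [Multiset.mem_cons] at h1 ⊢
      rintro i (rfl | hi)
      · omega
      · exact h1 i (.inr hi)
    have hcard' : ((j + 1) ::ₘ s).card ≤ ((j + 1) ::ₘ s).sum := by
      simpa using Multiset.card_nsmul_le_sum (a := 1) hs'.1
    obtain ⟨q', h1, h2, h3, h4⟩ := ih _ hs' hcard' fun t ht => by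
      rw [Nat.add_sub_cancel_left]
      exact gdet_mul_broom_balancedLegs ht (hc t ht) hs'.1 q
    have hsum : q + 1 + (j ::ₘ s).sum = q + ((j + 1) ::ₘ s).sum := by simp; ring
    have hcd : (j ::ₘ s).card = ((j + 1) ::ₘ s).card := by simp
    rw [hsum, hcd]
    refine ⟨q', h1, h2, h3, fun t ht => (h4 t ht).trans ?_⟩
    have hup := (hc t ht).iterate_up ht q
    have := gdet_slide ht (Z := (up t)^[q] (c t)) (Y := star t s) (E := pathNet t j)
      (star_nonneg ht s) ?_ 1
    · rw [Function.iterate_one, ← pathNet_succ] at this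
      rw [broom, ← gdet_iterate_up_mul, broom, ← gdet_iterate_up_mul,
        Function.iterate_succ_apply', gdet_up_mul, star_cons, star_cons]
      rwa [mul_assoc, mul_comm (star t s)] at this
    -- Seen from the last but one vertex of the path, `c` conducts at least like a path with `q + k`
    -- edges, and the short leg has at most that many.
    · refine cross_trans hup (pathNet_fst_pos ht (q + k)) (pathNet_nonneg ht j) ?_ (cross_pathNet ht (by omega))
      rw [← iterate_up_pathNet, cross_iterate_up]
      exact hk t ht

end UnicyclicLEL

namespace UnicyclicLEL
open Matrix

/-! ### Grounded Laplacians -/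

section Matrix
variable {V : Type*} [Fintype V] [DecidableEq V]

/-- The matrix agrees with the identity outside `A × A`. -/
def SupportedOn (A : Set V) (M : Matrix V V ℝ) : Prop :=
  ∀ i j, i ∉ A ∨ j ∉ A → M i j = (1 : Matrix V V ℝ) i j

lemma SupportedOn.inv {A : Set V} {M : Matrix V V ℝ} (h : SupportedOn A M) (hM : IsUnit M.det) :
    SupportedOn A M⁻¹ := by
  rintro i j (hi | hj)
  · rw [← mul_nonsing_inv M hM, mul_apply, Finset.sum_eq_single i]
    · rw [h i i (.inl hi), one_apply_eq, one_mul]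
    · intro k _ hk
      rw [h i k (.inl hi), one_apply_ne hk.symm, zero_mul]
    · simp
  · rw [← nonsing_inv_mul M hM, mul_apply, Finset.sum_eq_single j]
    · rw [h j j (.inl hj), one_apply_eq, mul_one]
    · intro k _ hk
      rw [h k j (.inr hj), one_apply_ne hk, mul_zero]
    · simp

/-- Padding by the identity keeps all parts over the same index type: matrices living on disjoint
parts are combined by multiplication, and their determinants multiply. -/
lemma SupportedOn.mul_eq {A B : Set V} (hAB : Disjoint A B) {M N : Matrix V V ℝ}
    (hM : SupportedOn A M) (hN : SupportedOn B N) : M * N = M + N - 1 := by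
  have h0 : (M - 1) * (N - 1) = 0 := by
    ext i j
    rw [mul_apply]
    refine Finset.sum_eq_zero fun k _ => ?_
    by_cases hk : k ∈ A
    · rw [Matrix.sub_apply N, hN k j (.inl (Set.disjoint_left.1 hAB hk)), sub_self, mul_zero]
    · rw [Matrix.sub_apply, hM i k (.inr hk), sub_self, zero_mul]
  have : M * N = (M - 1) * (N - 1) + M + N - 1 := by noncomm_ring
  rw [this, h0, zero_add]

lemma det_add_rankOne {M : Matrix V V ℝ} (hM : IsUnit M.det) (u v : V → ℝ) :
    (M + vecMulVec u v).det = M.det * (1 + v ⬝ᵥ (M⁻¹ *ᵥ u)) := by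
  have h1 : vecMulVec u v = replicateCol Unit u * replicateRow Unit v :=
    vecMulVec_eq Unit u v
  rw [h1, det_add_replicateCol_mul_replicateRow hM, det_unique (n := Unit)]
  simp only [Matrix.add_apply, one_apply_eq, Matrix.mul_assoc]
  rw [← replicateCol_mulVec, replicateRow_mul_replicateCol_apply]

/-- The incidence vector of an edge. -/
def edgeVec (r z : V) : V → ℝ := Pi.single r 1 - Pi.single z 1

lemma dotProduct_edgeVec (M : Matrix V V ℝ) (r z : V) :
    edgeVec r z ⬝ᵥ (M *ᵥ edgeVec r z) = M r r - M r z - M z r + M z z := by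
  simp [edgeVec, mulVec_sub, sub_dotProduct]
  ring

/-- Joining two matrices with disjoint supports by an edge. -/
lemma det_mul_add_edge {A B : Set V} (hAB : Disjoint A B) {M N : Matrix V V ℝ}
    (hM : SupportedOn A M) (hN : SupportedOn B N) (hMu : IsUnit M.det) (hNu : IsUnit N.det)
    {r z : V} (hr : r ∈ A) (hz : z ∈ B) :
    (M + N - 1 + vecMulVec (edgeVec r z) (edgeVec r z)).det =
      M.det * N.det * (1 + M⁻¹ r r + N⁻¹ z z) := by
  have hz' := Set.disjoint_right.1 hAB hz
  have hr' := Set.disjoint_left.1 hAB hr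
  have hrz : r ≠ z := fun h => hz' (h ▸ hr)
  have hM' := hM.inv hMu
  have hN' := hN.inv hNu
  rw [← hM.mul_eq hAB hN, det_add_rankOne (by rw [det_mul]; exact hMu.mul hNu),
    dotProduct_edgeVec, det_mul, Matrix.mul_inv_rev, hN'.mul_eq hAB.symm hM']
  simp only [Matrix.sub_apply, Matrix.add_apply, one_apply_eq, one_apply_ne hrz, one_apply_ne hrz.symm,
    hN' r r (.inl hr'), hN' r z (.inl hr'), hN' z r (.inr hr'), hM' z z (.inl hz'),
    hM' r z (.inr hz'), hM' z r (.inl hz')]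
  ring

/-- The Laplacian of a weighted graph. -/
def weightedLap (α : Matrix V V ℝ) : Matrix V V ℝ := diagonal (fun i => ∑ k, α i k) - α

lemma weightedLap_add (α β : Matrix V V ℝ) :
    weightedLap (α + β) = weightedLap α + weightedLap β := by
  simp only [weightedLap, Matrix.add_apply, Finset.sum_add_distrib, ← diagonal_add]
  abel

lemma weightedLap_edge {r z : V} (h : r ≠ z) :
    weightedLap (single r z 1 + single z r 1) = vecMulVec (edgeVec r z) (edgeVec r z) := by
  ext i j
  simp only [weightedLap, Matrix.sub_apply, diagonal_apply, Matrix.add_apply, single_apply, vecMulVec_apply,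
    edgeVec, Pi.sub_apply, Pi.single_apply, Finset.sum_add_distrib]
  by_cases h1 : i = r <;> by_cases h2 : i = z <;> by_cases h3 : j = r <;> by_cases h4 : j = z <;>
    simp_all [eq_comm]

end Matrix

/-! ### Determinants of induced networks: joining, transport, adding an edge -/

section Grounded
variable {V : Type*}

/-- The edges within a set of vertices. -/
def restr (G : SimpleGraph V) (S : Set V) : SimpleGraph V where
  Adj a b := G.Adj a b ∧ a ∈ S ∧ b ∈ S
  symm := ⟨fun _ _ h => ⟨h.1.symm, h.2.2, h.2.1⟩⟩
  loopless := ⟨fun _ h => h.1.ne rfl⟩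

@[simp] lemma restr_adj {G : SimpleGraph V} {S : Set V} {a b : V} :
    (restr G S).Adj a b ↔ G.Adj a b ∧ a ∈ S ∧ b ∈ S := Iff.rfl

open Classical

/-- The conductances to the ground. -/
noncomputable def groundWeight (S : Set V) (t : ℝ) (r : V) (x : ℝ) (v : V) : ℝ :=
  (if v ∈ S then t else 1) + if v = r then x else 0

variable [Fintype V]

/-- The Laplacian of the graph induced on `S`, with ground conductance `t` at every vertex of `S`
and an extra conductance `x` at `r`. -/
noncomputable def grounded (G : SimpleGraph V) (S : Set V) (t : ℝ) (r : V) (x : ℝ) :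
    Matrix V V ℝ :=
  diagonal (groundWeight S t r x) + (restr G S).lapMatrix ℝ

lemma lapMatrix_eq_weightedLap (G : SimpleGraph V) :
    G.lapMatrix ℝ = weightedLap (G.adjMatrix ℝ) := by
  ext i j
  simp [SimpleGraph.lapMatrix, weightedLap, SimpleGraph.degMatrix,
    SimpleGraph.degree_eq_sum_if_adj, SimpleGraph.adjMatrix_apply]

lemma grounded_posDef (G : SimpleGraph V) (S : Set V) {t : ℝ} (ht : 0 < t) (r : V) {x : ℝ}
    (hx : 0 ≤ x) : (grounded G S t r x).PosDef := by
  refine PosDef.add_posSemidef (PosDef.diagonal fun v => ?_)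
    (SimpleGraph.posSemidef_lapMatrix ℝ _)
  rw [groundWeight]
  split_ifs <;> linarith

/-- `groundWeight` has the value 1 off `S` to make this true; the root must lie in `S` so that `x`
does not spoil it. -/
lemma grounded_supportedOn (G : SimpleGraph V) (S : Set V) (t : ℝ) {r : V} (hr : r ∈ S)
    (x : ℝ) : SupportedOn S (grounded G S t r x) := by
  intro i j hij
  have h : ¬ (restr G S).Adj i j := fun h => by
    rcases hij with hi | hj
    · exact hi h.2.1
    · exact hj h.2.2
  rcases eq_or_ne i j with rfl | hne
  · have hi : i ∉ S := by simpa using hij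
    have hir : i ≠ r := fun h => hi (h ▸ hr)
    rw [grounded, lapMatrix_eq_weightedLap]
    simp [weightedLap, groundWeight, hi, hir, SimpleGraph.adjMatrix_apply]
  · rw [grounded, lapMatrix_eq_weightedLap]
    simp [weightedLap, hne, SimpleGraph.adjMatrix_apply, -restr_adj, h]

lemma grounded_add (G : SimpleGraph V) (S : Set V) (t : ℝ) (r : V) (x y : ℝ) :
    grounded G S t r (x + y) =
      grounded G S t r x + vecMulVec (Pi.single r y) (Pi.single r 1) := by
  ext i j
  simp only [grounded, groundWeight, Matrix.add_apply, diagonal_apply, vecMulVec_apply, Pi.single_apply]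
  by_cases h1 : i = j <;> by_cases h2 : i = r <;> by_cases h3 : j = r <;> simp_all; ring

/-- The network `c` describes the graph induced on `S` with root `r`. -/
structure Describes (G : SimpleGraph V) (S : Set V) (t : ℝ) (r : V) (c : DualNumber ℝ) :
    Prop where
  mem : r ∈ S
  pos : 0 < c.fst
  nonneg : 0 ≤ c.snd
  det_eq : ∀ x, 0 ≤ x → (grounded G S t r x).det = c.fst * (t + x) + c.snd

lemma grounded_isUnit (G : SimpleGraph V) (S : Set V) {t : ℝ} (ht : 0 < t) (r : V) {x : ℝ}
    (hx : 0 ≤ x) : IsUnit (grounded G S t r x).det :=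
  (grounded_posDef G S ht r hx).det_pos.ne'.isUnit

lemma det_grounded_add (G : SimpleGraph V) (S : Set V) {t : ℝ} (ht : 0 < t) (r : V) {x : ℝ}
    (hx : 0 ≤ x) (y : ℝ) : (grounded G S t r (x + y)).det =
      (grounded G S t r x).det * (1 + y * (grounded G S t r x)⁻¹ r r) := by
  rw [grounded_add, det_add_rankOne (grounded_isUnit G S ht r hx)]
  congr 2
  simp [mulVec_single]

/-- Both sides are the slope of the determinant as a function of the extra conductance at the root.
-/
lemma Describes.inv_apply {G : SimpleGraph V} {S : Set V} {t : ℝ} (ht : 0 < t) {r : V}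
    {c : DualNumber ℝ} (h : Describes G S t r c) {x : ℝ} (hx : 0 ≤ x) :
    (grounded G S t r x).det * (grounded G S t r x)⁻¹ r r = c.fst := by
  have h1 := h.det_eq (x + 1) (by linarith)
  rw [det_grounded_add G S ht r hx, mul_add, h.det_eq x hx] at h1
  rw [h.det_eq x hx]
  linarith

lemma describes_singleton (G : SimpleGraph V) {t : ℝ} (r : V) : Describes G {r} t r 1 := by
  refine ⟨rfl, by simp, by simp, fun x _ => ?_⟩
  have hadj : ∀ a b, ¬ (restr G {r}).Adj a b := by
    rintro a b ⟨h, rfl, rfl⟩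
    exact h.ne rfl
  have h2 : grounded G {r} t r x = diagonal fun v => if v = r then t + x else 1 := by
    rw [grounded, lapMatrix_eq_weightedLap]
    ext i j
    rcases eq_or_ne i j with rfl | hij
    · by_cases hi : i = r <;>
        simp [weightedLap, groundWeight, SimpleGraph.adjMatrix_apply, hadj, -restr_adj, hi]
    · simp [weightedLap, SimpleGraph.adjMatrix_apply, hadj, -restr_adj, hij]
  rw [h2, det_diagonal]
  simp

/-- Joining two rooted graphs by an edge between the roots. -/
theorem Describes.join {G : SimpleGraph V} {A B : Set V} {t : ℝ} (ht : 0 < t) {r z : V}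
    {a b : DualNumber ℝ} (ha : Describes G A t r a) (hb : Describes G B t z b)
    (hAB : Disjoint A B) (hrz : G.Adj r z)
    (hedge : ∀ i ∈ A, ∀ j ∈ B, G.Adj i j → i = r ∧ j = z) :
    Describes G (A ∪ B) t r (a * up t b) := by
  have hb' : Nonneg (up t b) := Nonneg.up ht ⟨hb.pos.le, hb.nonneg⟩
  have ha0 := ha.pos
  have hb0 := hb.pos
  have ha1 := ha.nonneg
  have hb1 := hb.nonneg
  refine ⟨.inl ha.mem, ?_, (Nonneg.mul ⟨ha0.le, ha1⟩ hb').2, fun x hx => ?_⟩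
  · simp; positivity
  -- Each of the two matrices is the identity off its own part, so in the sum every diagonal entry
  -- is too large by 1.
  have key : grounded G (A ∪ B) t r x = grounded G A t r x + grounded G B t z 0 - 1
      + vecMulVec (edgeVec r z) (edgeVec r z) := by
    have hadj : (restr G (A ∪ B)).adjMatrix ℝ = (restr G A).adjMatrix ℝ
        + (restr G B).adjMatrix ℝ + (single r z 1 + single z r 1) := by
      ext i j
      simp only [Matrix.add_apply, SimpleGraph.adjMatrix_apply, single_apply, restr_adj, Set.mem_union]
      have d1 := Set.disjoint_left.1 hAB
      have e1 := hedge i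
      have e2 := hedge j
      have hrA := ha.mem
      have hzB := hb.mem
      by_cases hij : G.Adj i j
      · by_cases hiA : i ∈ A
        · have hiB := d1 hiA
          have hzi : z ≠ i := fun h => hiB (h ▸ hzB)
          by_cases hjA : j ∈ A
          · have hjB := d1 hjA
            have hzj : z ≠ j := fun h => hjB (h ▸ hzB)
            simp [hij, hiA, hjA, hiB, hzi, hzj]
          · by_cases hjB : j ∈ B
            · obtain ⟨rfl, rfl⟩ := e1 hiA j hjB hij
              simp [hij, hiA, hjA, hjB, hiB, hij.ne, hij.ne']
            · have : z ≠ j := fun h => hjB (h ▸ hzB)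
              simp [hjA, hjB, this, hzi]
        · have hri : r ≠ i := fun h => hiA (h ▸ hrA)
          by_cases hiB : i ∈ B
          · by_cases hjA : j ∈ A
            · obtain ⟨rfl, rfl⟩ := e2 hjA i hiB hij.symm
              have hjB := d1 hjA
              simp [hij, hiA, hjA, hjB, hiB, hij.ne, hij.ne']
            · have hrj : r ≠ j := fun h => hjA (h ▸ hrA)
              simp [hij, hiA, hiB, hjA, hri, hrj]
          · have : z ≠ i := fun h => hiB (h ▸ hzB)
            simp [hiA, hiB, this, hri]
      · have h1 : ¬ (r = i ∧ z = j) := by rintro ⟨rfl, rfl⟩; exact hij hrz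
        have h2 : ¬ (z = i ∧ r = j) := by rintro ⟨rfl, rfl⟩; exact hij hrz.symm
        simp [hij, h1, h2]
    rw [grounded, grounded, grounded, lapMatrix_eq_weightedLap, lapMatrix_eq_weightedLap,
      lapMatrix_eq_weightedLap, hadj, weightedLap_add, weightedLap_add, weightedLap_edge hrz.ne]
    have hdiag : diagonal (groundWeight (A ∪ B) t r x)
        = diagonal (groundWeight A t r x) + diagonal (groundWeight B t z 0) - 1 := by
      rw [← diagonal_one, diagonal_add, diagonal_sub]
      congr 1
      ext v
      have : v ∈ A → v ∉ B := fun h => Set.disjoint_left.1 hAB h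
      by_cases h1 : v ∈ A <;> by_cases h2 : v ∈ B <;> simp_all [groundWeight]
      ring
    rw [hdiag]
    abel
  rw [key, det_mul_add_edge hAB (grounded_supportedOn G A t ha.mem x)
    (grounded_supportedOn G B t hb.mem 0) (grounded_isUnit G A ht r hx)
    (grounded_isUnit G B ht z le_rfl) ha.mem hb.mem]
  have h1 := ha.inv_apply ht hx
  have h2 := hb.inv_apply ht le_rfl
  have h3 := ha.det_eq x hx
  have h4 := hb.det_eq 0 le_rfl
  rw [h3] at h1 ⊢
  rw [h4] at h2 ⊢
  simp
  linear_combination (b.fst * t + b.snd) * h1 + (a.fst * (t + x) + a.snd) * h2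

/-- Graph isomorphisms onto an induced subgraph preserve the description. -/
theorem Describes.map {W : Type*} [Fintype W] {G : SimpleGraph W} {H : SimpleGraph V} {t : ℝ}
    {r : W} {c : DualNumber ℝ} (h : Describes G Set.univ t r c) (f : W → V)
    (hf : Function.Injective f) (hadj : ∀ a b, H.Adj (f a) (f b) ↔ G.Adj a b) :
    Describes H (Set.range f) t (f r) c := by
  refine ⟨⟨r, rfl⟩, h.pos, h.nonneg, fun x hx => ?_⟩
  rw [← h.det_eq x hx]
  -- With the 0-1 matrix of `f`, the matrix over `V` is `1 + P (N - 1) Pᵀ`. Sylvester's identity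
  -- moves the determinant to `W`, where `Pᵀ P = 1` by injectivity.
  set P : Matrix V W ℝ := of fun v w => if v = f w then 1 else 0 with hP
  have hsum : ∀ (N : Matrix W W ℝ) v v', (P * (N * Pᵀ)) v v' =
      ∑ w, ∑ w', if v = f w ∧ v' = f w' then N w w' else 0 := by
    intro N v v'
    simp [mul_apply, hP, ite_and]
  have key : grounded H (Set.range f) t (f r) x =
      1 + P * ((grounded G Set.univ t r x - 1) * Pᵀ) := by
    ext v v'
    rw [Matrix.add_apply, hsum]
    by_cases hv : v ∈ Set.range f ∧ v' ∈ Set.range f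
    · obtain ⟨⟨w, rfl⟩, ⟨w', rfl⟩⟩ := hv
      have : ∀ i j, (f w = f i ∧ f w' = f j) ↔ (i = w ∧ j = w') := by
        intro i j
        rw [hf.eq_iff, hf.eq_iff, eq_comm, @eq_comm _ w']
      simp only [this, ite_and]
      simp only [Finset.sum_ite_irrel, Finset.sum_const_zero, Finset.sum_ite_eq', Finset.mem_univ,
        if_true]
      have hdeg : ∑ k, (if (restr G Set.univ).Adj w k then (1 : ℝ) else 0) =
          ∑ k, if (restr H (Set.range f)).Adj (f w) k then (1 : ℝ) else 0 := by
        refine Finset.sum_of_injOn f hf.injOn (by simp [Set.MapsTo]) ?_ ?_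
        · intro k _ hk
          rw [if_neg]
          rintro ⟨-, -, k', rfl⟩
          exact hk ⟨k', by simp, rfl⟩
        · intro k _
          simp [hadj]
      rw [grounded, grounded, lapMatrix_eq_weightedLap, lapMatrix_eq_weightedLap]
      simp only [weightedLap, Matrix.add_apply, Matrix.sub_apply, diagonal_apply, SimpleGraph.adjMatrix_apply,
        hdeg, hf.eq_iff, one_apply]
      simp [hadj, groundWeight, hf.eq_iff]
    · rw [grounded_supportedOn H _ t (Set.mem_range_self r) x v v' (by tauto)]
      rw [Finset.sum_eq_zero, add_zero]
      intro w _
      refine Finset.sum_eq_zero fun w' _ => if_neg ?_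
      rintro ⟨rfl, rfl⟩
      exact hv ⟨⟨w, rfl⟩, ⟨w', rfl⟩⟩
  have hPP : Pᵀ * P = 1 := by
    ext i j
    simp only [mul_apply, hP, transpose_apply, of_apply, one_apply]
    simp [hf.eq_iff, eq_comm]
  rw [key, det_one_add_mul_comm, Matrix.mul_assoc, hPP, Matrix.mul_one, add_sub_cancel]

/-- Adding an edge increases the conductance at the root. -/
theorem Describes.add_edge {G G' : SimpleGraph V} {S : Set V} {t : ℝ} (ht : 0 < t) {r y z : V}
    {c : DualNumber ℝ} (h : Describes G S t r c) (hyz : y ≠ z)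
    (hadj : (restr G' S).adjMatrix ℝ =
      (restr G S).adjMatrix ℝ + (single y z 1 + single z y 1)) :
    ∃ c', Describes G' S t r c' ∧ 0 ≤ cross c' c := by
  set M := grounded G S t r 0 with hM
  set M' := grounded G' S t r 0 with hM'
  have key : M' = M + vecMulVec (edgeVec y z) (edgeVec y z) := by
    rw [hM, hM', grounded, grounded, lapMatrix_eq_weightedLap, lapMatrix_eq_weightedLap, hadj,
      weightedLap_add, weightedLap_edge hyz, add_assoc]
  have hp := grounded_posDef G S ht r le_rfl
  have hp' := grounded_posDef G' S ht r le_rfl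
  rw [← hM] at hp
  rw [← hM'] at hp'
  have hu : IsUnit M.det := hp.det_pos.ne'.isUnit
  have hu' : IsUnit M'.det := hp'.det_pos.ne'.isUnit
  -- The potentials produced by a unit current into the root, before and after the edge is added;
  -- their values at `r` are the resistances to the ground.
  set w := M⁻¹ *ᵥ Pi.single r 1 with hw
  set w' := M'⁻¹ *ᵥ Pi.single r 1 with hw'
  have hMw : M *ᵥ w = Pi.single r 1 := by
    rw [hw, mulVec_mulVec, mul_nonsing_inv _ hu, one_mulVec]
  have hMw' : M' *ᵥ w' = Pi.single r 1 := by
    rw [hw', mulVec_mulVec, mul_nonsing_inv _ hu', one_mulVec]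
  have hwr : w r = M⁻¹ r r := by simp [hw]
  have hwr' : w' r = M'⁻¹ r r := by simp [hw']
  have hle : M'⁻¹ r r ≤ M⁻¹ r r := by
    rw [← hwr, ← hwr']
    -- Rayleigh monotonicity: this energy equals `w r - w' r` minus the square of the potential
    -- difference of `w'` across the new edge.
    have h1 := hp.posSemidef.dotProduct_mulVec_nonneg (w - w')
    have h2 : w ⬝ᵥ (M *ᵥ w') = w' r := by
      have : Mᵀ = M := by simpa using hp.isHermitian.eq
      rw [dotProduct_mulVec, ← mulVec_transpose, this, hMw, single_dotProduct, one_mul]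
    have h3 : w' ⬝ᵥ (M *ᵥ w') = w' r - (edgeVec y z ⬝ᵥ w') ^ 2 := by
      have : M *ᵥ w' = M' *ᵥ w' - (edgeVec y z ⬝ᵥ w') • edgeVec y z := by
        rw [key, add_mulVec, vecMulVec_mulVec]
        simp
      rw [this, hMw', dotProduct_sub, dotProduct_smul, dotProduct_comm w' (edgeVec y z)]
      simp [sq]
    simp only [star_trivial, mulVec_sub, sub_dotProduct, dotProduct_sub, hMw, h2, h3] at h1
    simp at h1
    nlinarith [sq_nonneg (edgeVec y z ⬝ᵥ w')]
  have hpos' : 0 < M'⁻¹ r r := hp'.inv.diag_pos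
  have h1 := h.inv_apply ht le_rfl
  have h2 := h.det_eq 0 le_rfl
  rw [← hM] at h1 h2
  have hd := hp.det_pos
  have hd' := hp'.det_pos
  have hc0 := h.pos
  have hc1 := h.nonneg
  -- Both components are forced: `fst` is the slope of the determinant, and `t * fst + snd` is its
  -- value at zero extra conductance.
  set c' : DualNumber ℝ := TrivSqZeroExt.inl (M'.det * M'⁻¹ r r) +
    TrivSqZeroExt.inr (M'.det - t * (M'.det * M'⁻¹ r r)) with hc'
  have hf : c'.fst = M'.det * M'⁻¹ r r := by simp [hc']
  have hs : c'.snd = M'.det - t * (M'.det * M'⁻¹ r r) := by simp [hc']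
  have hcross : 0 ≤ cross c' c := by
    have h3 : c.snd = M.det - t * (M.det * M⁻¹ r r) := by linear_combination -h2 + t * h1
    rw [cross, hf, hs, h3, ← h1]
    have := mul_nonneg (mul_pos hd hd').le (sub_nonneg.2 hle)
    linear_combination this
  refine ⟨c', ⟨h.mem, by rw [hf]; positivity, ?_, fun x hx => ?_⟩, hcross⟩
  · refine nonneg_of_mul_nonneg_left (b := c.fst) ?_ hc0
    rw [cross, sub_nonneg] at hcross
    refine le_trans (mul_nonneg ?_ hc1) hcross
    rw [hf]; positivity
  · have := det_grounded_add G' S ht r le_rfl x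
    rw [zero_add, ← hM'] at this
    rw [this, hf, hs]
    ring

/-! ### Comparing Laplacian-like energies -/

lemma det_grounded_univ (G : SimpleGraph V) (t : ℝ) (r : V) :
    (grounded G Set.univ t r 0).det =
      ∏ i, (t + (SimpleGraph.isHermitian_lapMatrix (R := ℝ) G).eigenvalues i) := by
  set hA := SimpleGraph.isHermitian_lapMatrix (R := ℝ) G
  have h2 : grounded G Set.univ t r 0 = -(scalar V (-t) - G.lapMatrix ℝ) := by
    rw [grounded, lapMatrix_eq_weightedLap, lapMatrix_eq_weightedLap]
    ext i j
    by_cases h : i = j <;>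
      simp [h, weightedLap, groundWeight, SimpleGraph.adjMatrix_apply, add_comm]
  have h3 := congrArg (Polynomial.eval (-t)) hA.charpoly_eq
  rw [eval_charpoly, Polynomial.eval_prod] at h3
  rw [h2, det_neg, h3, ← Finset.card_univ, ← Finset.prod_const, ← Finset.prod_mul_distrib]
  refine Finset.prod_congr rfl fun i _ => ?_
  simp; ring

/-- An antiderivative of `log (1 + μ / t ^ 2)` on the positive half-line. -/
noncomputable def logPrimitive (μ t : ℝ) : ℝ :=
  t * (Real.log (t ^ 2 + μ) - 2 * Real.log t) + 2 * √μ * Real.arctan (t / √μ)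

lemma hasDerivAt_logPrimitive {μ t : ℝ} (hμ : 0 ≤ μ) (ht : 0 < t) :
    HasDerivAt (logPrimitive μ) (Real.log (t ^ 2 + μ) - 2 * Real.log t) t := by
  have hp : 0 < t ^ 2 + μ := by positivity
  have h1 : HasDerivAt (fun t => Real.log (t ^ 2 + μ)) (2 * t / (t ^ 2 + μ)) t := by
    have := (((hasDerivAt_id t).pow 2).add_const μ).log hp.ne'
    simpa using this
  have h2 := (hasDerivAt_id t).mul (h1.sub ((Real.hasDerivAt_log ht.ne').const_mul 2))
  have h3 := (((hasDerivAt_id t).div_const (√μ)).arctan).const_mul (2 * √μ)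
  refine (h2.add h3).congr_deriv ?_
  rcases hμ.eq_or_lt with rfl | hμ
  · simp; field_simp; simp
  · have hs : 0 < √μ := Real.sqrt_pos.2 hμ
    have hsq : √μ ^ 2 = μ := Real.sq_sqrt hμ.le
    have h4 : 1 + (t / √μ) ^ 2 = (t ^ 2 + μ) / μ := by
      rw [div_pow, hsq]; field_simp; ring
    simp only [id, h4, Pi.sub_apply]
    field_simp
    ring

lemma tendsto_logPrimitive_zero (μ : ℝ) (hμ : 0 ≤ μ) :
    Filter.Tendsto (logPrimitive μ) (nhdsWithin 0 (Set.Ioi 0)) (nhds 0) := by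
  have h1 : Filter.Tendsto (fun t : ℝ => t * Real.log t) (nhdsWithin 0 (Set.Ioi 0)) (nhds 0) := by
    have := Real.continuous_mul_log.tendsto 0
    simp only [zero_mul] at this
    exact this.mono_left nhdsWithin_le_nhds
  have h3 : Filter.Tendsto (fun t : ℝ => 2 * √μ * Real.arctan (t / √μ))
      (nhdsWithin 0 (Set.Ioi 0)) (nhds 0) := by
    have : Continuous fun t : ℝ => 2 * √μ * Real.arctan (t / √μ) := by fun_prop
    have := this.tendsto 0
    simp only [zero_div, Real.arctan_zero, mul_zero] at this
    exact this.mono_left nhdsWithin_le_nhds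
  have h2 : Filter.Tendsto (fun t : ℝ => t * Real.log (t ^ 2 + μ))
      (nhdsWithin 0 (Set.Ioi 0)) (nhds 0) := by
    rcases hμ.eq_or_lt with rfl | hμ
    · have := h1.const_mul 2
      rw [mul_zero] at this
      refine this.congr fun t => ?_
      rw [add_zero, Real.log_pow]; push_cast; ring
    · have : ContinuousAt (fun t : ℝ => t * Real.log (t ^ 2 + μ)) 0 := by
        refine continuousAt_id.mul (ContinuousAt.log (by fun_prop) ?_)
        positivity
      have := this.tendsto
      simp only [zero_mul] at this
      exact this.mono_left nhdsWithin_le_nhds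
  have := (h2.sub (h1.const_mul 2)).add h3
  simp only [mul_zero, sub_zero, add_zero] at this
  refine this.congr fun t => ?_
  rw [logPrimitive]; ring

/-- The logarithmic term lies between 0 and `μ / t` because log (1 + y) ≤ y; the limit comes from
the arctangent alone. -/
lemma tendsto_logPrimitive_atTop (μ : ℝ) (hμ : 0 ≤ μ) :
    Filter.Tendsto (logPrimitive μ) Filter.atTop (nhds (Real.pi * √μ)) := by
  have h1 : Filter.Tendsto (fun t : ℝ => t * (Real.log (t ^ 2 + μ) - 2 * Real.log t))
      Filter.atTop (nhds 0) := by
    have hup : Filter.Tendsto (fun t : ℝ => μ / t) Filter.atTop (nhds 0) :=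
      tendsto_const_nhds.div_atTop Filter.tendsto_id
    refine tendsto_of_tendsto_of_tendsto_of_le_of_le' tendsto_const_nhds hup ?_ ?_
    · filter_upwards [Filter.eventually_gt_atTop 0] with t ht
      refine mul_nonneg ht.le (sub_nonneg.2 ?_)
      rw [show 2 * Real.log t = Real.log (t ^ 2) by rw [Real.log_pow]; norm_num]
      exact Real.log_le_log (by positivity) (by simpa using hμ)
    · filter_upwards [Filter.eventually_gt_atTop 0] with t ht
      have h2 : Real.log (t ^ 2 + μ) - 2 * Real.log t = Real.log (1 + μ / t ^ 2) := by
        rw [show 2 * Real.log t = Real.log (t ^ 2) by rw [Real.log_pow]; norm_num,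
          ← Real.log_div (by positivity) (by positivity)]
        congr 1
        field_simp
      have h3 := Real.log_le_sub_one_of_pos (x := 1 + μ / t ^ 2) (by positivity)
      rw [h2]
      calc t * Real.log (1 + μ / t ^ 2) ≤ t * (μ / t ^ 2) := by
            gcongr; linarith
        _ = μ / t := by field_simp
  have h2 : Filter.Tendsto (fun t : ℝ => 2 * √μ * Real.arctan (t / √μ))
      Filter.atTop (nhds (Real.pi * √μ)) := by
    rcases hμ.eq_or_lt with rfl | hμ
    · simp
    · have h := (Real.tendsto_arctan_atTop.mono_right nhdsWithin_le_nhds).comp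
        (Filter.tendsto_id.atTop_div_const (Real.sqrt_pos.2 hμ))
      have := h.const_mul (2 * √μ)
      rw [show 2 * √μ * (Real.pi / 2) = Real.pi * √μ by ring] at this
      exact this
  have := h1.add h2
  rw [zero_add] at this
  exact this

/-- The difference `F` of the sums of primitives has as derivative the difference of the
log-determinants at `t ^ 2`, the terms `2 log t` cancelling because the orders agree. So `F`
increases from 0 to π times the difference of the energies. The roots are arbitrary, as no extra
conductance is present. -/
theorem LEL_le {W : Type*} [Fintype W] {G : SimpleGraph V} {H : SimpleGraph W}
    (hcard : Fintype.card V = Fintype.card W) {r : V} {s : W}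
    (h : ∀ t, 0 < t → (grounded G Set.univ t r 0).det ≤ (grounded H Set.univ t s 0).det) :
    LEL G ≤ LEL H := by
  set a := (SimpleGraph.isHermitian_lapMatrix (R := ℝ) G).eigenvalues with ha
  set b := (SimpleGraph.isHermitian_lapMatrix (R := ℝ) H).eigenvalues with hb
  have ha0 : ∀ i, 0 ≤ a i := (SimpleGraph.posSemidef_lapMatrix ℝ G).eigenvalues_nonneg
  have hb0 : ∀ i, 0 ≤ b i := (SimpleGraph.posSemidef_lapMatrix ℝ H).eigenvalues_nonneg
  set F : ℝ → ℝ := fun t => ∑ i, logPrimitive (b i) t - ∑ i, logPrimitive (a i) t with hF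
  have hder : ∀ t, 0 < t → HasDerivAt F
      (∑ i, (Real.log (t ^ 2 + b i) - 2 * Real.log t)
        - ∑ i, (Real.log (t ^ 2 + a i) - 2 * Real.log t)) t := by
    intro t ht
    exact (HasDerivAt.fun_sum fun i _ => hasDerivAt_logPrimitive (hb0 i) ht).sub
      (HasDerivAt.fun_sum fun i _ => hasDerivAt_logPrimitive (ha0 i) ht)
  have hmono : MonotoneOn F (Set.Ioi 0) := by
    refine monotoneOn_of_deriv_nonneg (convex_Ioi 0)
      (fun t ht => (hder t ht).continuousAt.continuousWithinAt)
      (fun t ht => ?_) fun t ht => ?_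
    · rw [interior_Ioi] at ht
      exact (hder t ht).differentiableAt.differentiableWithinAt
    · rw [interior_Ioi] at ht
      rw [(hder t ht).deriv]
      have ht' : 0 < t := ht
      have h' := h (t ^ 2) (by positivity)
      rw [det_grounded_univ, det_grounded_univ] at h'
      have hlog := Real.log_le_log (Finset.prod_pos fun i _ => by
        have := ha0 i; positivity) h'
      rw [Real.log_prod (fun i _ => by have := ha0 i; positivity),
        Real.log_prod (fun i _ => by have := hb0 i; positivity)] at hlog
      simp only [Finset.sum_sub_distrib, Finset.sum_const, Finset.card_univ, hcard]
      linarith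
  have h0 : Filter.Tendsto F (nhdsWithin 0 (Set.Ioi 0)) (nhds 0) := by
    have := (tendsto_finsetSum Finset.univ fun i _ =>
      tendsto_logPrimitive_zero (b i) (hb0 i)).sub (tendsto_finsetSum Finset.univ fun i _ =>
      tendsto_logPrimitive_zero (a i) (ha0 i))
    simpa using this
  have hinf : Filter.Tendsto F Filter.atTop (nhds (Real.pi * (LEL H - LEL G))) := by
    have := (tendsto_finsetSum Finset.univ fun i _ =>
      tendsto_logPrimitive_atTop (b i) (hb0 i)).sub (tendsto_finsetSum Finset.univ fun i _ =>
      tendsto_logPrimitive_atTop (a i) (ha0 i))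
    rw [← Finset.mul_sum, ← Finset.mul_sum, ← mul_sub] at this
    exact this
  have hnn : ∀ t, 0 < t → 0 ≤ F t := by
    intro t ht
    refine le_of_tendsto h0 ?_
    filter_upwards [Ioo_mem_nhdsGT ht] with s hs
    exact hmono hs.1 ht hs.2.le
  have := ge_of_tendsto hinf (Filter.eventually_gt_atTop 0 |>.mono hnn)
  have := nonneg_of_mul_nonneg_right this Real.pi_pos
  linarith

end Grounded
end UnicyclicLEL

namespace UnicyclicLEL

/-! ### Paths and cycles -/

section Paths
variable {V : Type*} [Fintype V]

/-- Prolonging a rooted graph by a path. -/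
lemma Describes.chain {G : SimpleGraph V} {S : Set V} {t : ℝ} (ht : 0 < t) (w : ℕ → V)
    {c : DualNumber ℝ} (h : Describes G S t (w 0) c) (m : ℕ)
    (hS : ∀ i, i < m → w (i + 1) ∉ S) (hne : ∀ i j, j < i → i ≤ m → w i ≠ w j)
    (hadj : ∀ i, i < m → G.Adj (w i) (w (i + 1)))
    (honly : ∀ i, i < m → ∀ v ∈ S, G.Adj (w (i + 1)) v → v = w i)
    (honly' : ∀ i j, j ≤ i → i < m → G.Adj (w (i + 1)) (w j) → w j = w i) :
    Describes G (S ∪ {v | ∃ i < m, v = w (i + 1)}) t (w m) ((up t)^[m] c) := by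
  induction m with
  | zero => simpa using h
  | succ m ih =>
    have ih' := ih (fun i hi => hS i (by omega)) (fun i j hj hi => hne i j hj (by omega))
      (fun i hi => hadj i (by omega)) (fun i hi => honly i (by omega))
      (fun i j hj hi => honly' i j hj (by omega))
    have hj := (describes_singleton G (t := t) (w (m + 1))).join ht ih' ?_
      (hadj m (by omega)).symm ?_
    · rw [one_mul] at hj
      rw [Function.iterate_succ_apply']
      convert hj using 1
      ext v
      simp only [Set.mem_union, Set.mem_ofPred_eq, Set.mem_singleton_iff, Nat.lt_succ_iff_lt_or_eq,
        or_and_right, exists_or, exists_eq_left]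
      rw [← or_assoc, or_comm]
    · rw [Set.disjoint_singleton_left]
      rintro (h' | ⟨i, hi, h'⟩)
      · exact hS m (by omega) h'
      · exact hne (m + 1) (i + 1) (by omega) le_rfl h'
    · rintro _ rfl v (hv | ⟨i, hi, rfl⟩) h'
      · exact ⟨rfl, honly m (by omega) v hv h'⟩
      · exact ⟨rfl, honly' m (i + 1) (by omega) (by omega) h'⟩

lemma describes_pathGraph {t : ℝ} (ht : 0 < t) (m : ℕ) :
    Describes (SimpleGraph.pathGraph (m + 1)) Set.univ t 0 (pathNet t m) := by
  -- Vertices are counted down from the far end, so that the chain ends at the root 0.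
  set w : ℕ → Fin (m + 1) := fun j => ⟨m - j, by omega⟩ with hw
  have h := Describes.chain ht w
    (describes_singleton (SimpleGraph.pathGraph (m + 1)) (t := t) (w 0)) m ?_ ?_ ?_ ?_ ?_
  · have hm : w m = 0 := by simp [hw]
    rw [hm] at h
    have hS : {w 0} ∪ {v | ∃ i < m, v = w (i + 1)} = Set.univ := by
      refine Set.eq_univ_of_forall fun v => ?_
      by_cases hv : v.val = m
      · left; ext; simp [hw, hv]
      · right
        exact ⟨m - 1 - v.val, by omega, by ext; simp [hw]; omega⟩
    rwa [hS] at h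
  · intro i hi
    simp only [hw, Set.mem_singleton_iff, Fin.mk.injEq]; omega
  · intro i j hj hi
    simp only [hw, ne_eq, Fin.mk.injEq]; omega
  · intro i hi
    simp only [hw, SimpleGraph.pathGraph_adj]; omega
  · rintro i hi _ rfl
    simp only [hw, SimpleGraph.pathGraph_adj, Fin.mk.injEq]; omega
  · intro i j hj hi
    simp only [hw, SimpleGraph.pathGraph_adj, Fin.mk.injEq]; omega

lemma cycleGraph_adj_iff {m : ℕ} (hm : 2 ≤ m) (u v : Fin (m + 1)) :
    (SimpleGraph.cycleGraph (m + 1)).Adj u v ↔ u.val + 1 = v.val ∨ v.val + 1 = u.val ∨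
      (u.val = 0 ∧ v.val = m) ∨ (u.val = m ∧ v.val = 0) := by
  rw [SimpleGraph.cycleGraph_adj']
  have hu := u.isLt
  have hv := v.isLt
  rcases lt_trichotomy u v with h | rfl | h
  · have h' : u.val < v.val := h
    rw [Fin.coe_sub_iff_lt.2 h, Fin.coe_sub_iff_le.2 h.le]; omega
  · rw [sub_self]
    have : (0 : Fin (m + 1)).val = 0 := rfl
    omega
  · have h' : v.val < u.val := h
    rw [Fin.coe_sub_iff_lt.2 h, Fin.coe_sub_iff_le.2 h.le]; omega

/-- The network of a cycle, which conducts better than that of the path left after deleting an edge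
at the root. -/
lemma exists_describes_cycleGraph {t : ℝ} (ht : 0 < t) {m : ℕ} (hm : 2 ≤ m) :
    ∃ c, Describes (SimpleGraph.cycleGraph (m + 1)) Set.univ t 0 c ∧ 0 ≤ cross c (pathNet t m) := by
  classical
  refine (describes_pathGraph ht m).add_edge ht (y := 0) (z := Fin.last m) ?_ ?_
  · intro h
    have : 0 = m := congrArg Fin.val h
    omega
  ext i j
  simp only [Matrix.add_apply, SimpleGraph.adjMatrix_apply, restr_adj, Set.mem_univ, and_true,
    Matrix.single_apply, cycleGraph_adj_iff hm, SimpleGraph.pathGraph_adj, Fin.ext_iff,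
    Fin.val_zero, Fin.val_last]
  split_ifs <;> first | omega | norm_num

end Paths

/-! ### Decomposing trees -/

section Tree
variable {V : Type*}

lemma reachable_restr {G : SimpleGraph V} {z v : V} (h : G.Reachable z v) :
    (restr G {x | G.Reachable z x}).Reachable z v := by
  rw [SimpleGraph.reachable_iff_reflTransGen] at h
  induction h with
  | refl => exact .refl _
  | tail h1 h2 ih =>
    rw [← SimpleGraph.reachable_iff_reflTransGen] at h1
    exact ih.trans (SimpleGraph.Adj.reachable ⟨h2, h1, h1.trans h2.reachable⟩)

lemma exists_adj_of_reachable_ne {G : SimpleGraph V} {r v : V} (h : G.Reachable r v)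
    (hne : v ≠ r) : ∃ z, G.Adj r z := by
  rw [SimpleGraph.reachable_iff_reflTransGen] at h
  rcases Relation.ReflTransGen.cases_head h with h | ⟨z, hz, -⟩
  · exact absurd h.symm hne
  · exact ⟨z, hz⟩

/-- The leaves other than the root of the subgraph induced on `S`. -/
def leafSet (G : SimpleGraph V) (S : Set V) (r : V) : Set V :=
  {v | v ∈ S ∧ v ≠ r ∧ ∃! w, w ∈ S ∧ G.Adj v w}

/-- The two parts left after deleting an edge at the root of a tree. -/
lemma exists_split {G : SimpleGraph V} {S : Set V} {r z : V} (hr : r ∈ S)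
    (hac : (restr G S).IsAcyclic) (hconn : ∀ v ∈ S, (restr G S).Reachable r v)
    (hz : z ∈ S) (hrz : G.Adj r z) :
    ∃ A B : Set V, A ∪ B = S ∧ Disjoint A B ∧ r ∈ A ∧ z ∈ B ∧
      (∀ i ∈ A, ∀ j ∈ B, G.Adj i j → i = r ∧ j = z) ∧
      (∀ v ∈ A, (restr G A).Reachable r v) ∧ (∀ v ∈ B, (restr G B).Reachable z v) := by
  set K := restr G S with hK
  set H := K.deleteEdges {s(r, z)} with hH
  set B : Set V := {v | H.Reachable z v} with hB
  have hKrz : K.Adj r z := ⟨hrz, hr, hz⟩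
  have hbr : ¬ H.Reachable r z :=
    SimpleGraph.isBridge_iff.1 (SimpleGraph.isAcyclic_iff_forall_isBridge.1 hac
      ((SimpleGraph.mem_edgeSet K).2 hKrz))
  have hrB : r ∉ B := fun h => hbr (SimpleGraph.Reachable.symm h)
  have hzB : z ∈ B := .refl _
  have hBS : B ⊆ S := by
    intro v hv
    rcases eq_or_ne v z with rfl | hne
    · exact hz
    · obtain ⟨w, hw⟩ := exists_adj_of_reachable_ne (SimpleGraph.Reachable.symm hv) hne.symm
      exact ((SimpleGraph.deleteEdges_le _) hw : K.Adj v w).2.1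
  have hedge : ∀ i ∈ S \ B, ∀ j ∈ B, G.Adj i j → i = r ∧ j = z := by
    intro i hi j hj hij
    by_contra hne
    have : H.Adj j i := by
      rw [hH, SimpleGraph.deleteEdges_adj]
      refine ⟨⟨hij.symm, hBS hj, hi.1⟩, fun h => ?_⟩
      rw [Set.mem_singleton_iff, Sym2.eq_iff] at h
      rcases h with ⟨rfl, rfl⟩ | ⟨rfl, rfl⟩
      · exact hrB hj
      · exact hne ⟨rfl, rfl⟩
    exact hi.2 (SimpleGraph.Reachable.trans hj this.reachable)
  refine ⟨S \ B, B, Set.sdiff_union_of_subset hBS, Set.disjoint_sdiff_left, ⟨hr, hrB⟩, hzB, hedge,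
    ?_, ?_⟩
  · have key : ∀ v, K.Reachable r v → v ∈ B ∨ (restr G (S \ B)).Reachable r v := by
      intro v hv
      rw [SimpleGraph.reachable_iff_reflTransGen] at hv
      induction hv with
      | refl => exact .inr (.refl _)
      | @tail u v h1 h2 ih =>
        by_cases hvB : v ∈ B
        · exact .inl hvB
        have hvA : v ∈ S \ B := ⟨h2.2.2, hvB⟩
        by_cases huB : u ∈ B
        · obtain ⟨rfl, -⟩ := hedge v hvA u huB h2.1.symm
          exact .inr (.refl _)
        · exact .inr ((ih.resolve_left huB).trans
            (SimpleGraph.Adj.reachable ⟨h2.1, ⟨h2.2.1, huB⟩, hvA⟩))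
    exact fun v hv => (key v (hconn v hv.1)).resolve_left hv.2
  · intro v hv
    refine (reachable_restr hv).mono ?_
    intro a b hab
    exact ⟨((SimpleGraph.deleteEdges_le _) hab.1 : K.Adj a b).1, hab.2⟩

/-- The joining edge changes the degrees of `r` and `z` only. The root `r` is never counted, and `z`
becomes a leaf exactly when it is alone in `B`. -/
lemma leafSet_union {G : SimpleGraph V} {A B : Set V} {r z : V} (hAB : Disjoint A B)
    (hr : r ∈ A) (hz : z ∈ B) (hrz : G.Adj r z)
    (hedge : ∀ i ∈ A, ∀ j ∈ B, G.Adj i j → i = r ∧ j = z)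
    (hB : ∀ v ∈ B, (restr G B).Reachable z v) :
    leafSet G (A ∪ B) r = leafSet G A r ∪ {v | if B = {z} then v = z else v ∈ leafSet G B z} := by
  have hd := Set.disjoint_left.1 hAB
  ext v
  simp only [leafSet, Set.mem_union, Set.mem_ofPred_eq]
  by_cases hvA : v ∈ A
  · have hvB := hd hvA
    have hvz : v ≠ z := fun h => hvB (h ▸ hz)
    by_cases hvr : v = r
    · simp [hvr, hd hr, hrz.ne]
    have : ∀ w, ((w ∈ A ∨ w ∈ B) ∧ G.Adj v w) ↔ (w ∈ A ∧ G.Adj v w) := fun w =>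
      ⟨fun ⟨h1, h2⟩ => ⟨h1.resolve_right fun h => hvr (hedge v hvA w h h2).1, h2⟩,
        fun ⟨h1, h2⟩ => ⟨.inl h1, h2⟩⟩
    simp [hvA, hvB, hvz, hvr, this]
  by_cases hvB : v ∈ B
  · have hvr : v ≠ r := fun h => hvA (h ▸ hr)
    by_cases hvz : v = z
    · subst hvz
      by_cases hBz : B = {v}
      · simp only [hvA, hvr, hBz, or_true, true_and, if_true, ne_eq, not_false_eq_true,
          iff_true, Set.mem_singleton_iff]
        refine ⟨r, ⟨.inl hr, hrz.symm⟩, ?_⟩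
        rintro w ⟨hw | rfl, hvw⟩
        · exact (hedge w hw v hz hvw.symm).1
        · exact absurd hvw (G.loopless.irrefl _)
      · simp only [hvA, hvB, hvr, hBz, or_true, true_and, if_false, ne_eq, not_true_eq_false,
          not_false_eq_true, false_and, and_false, or_false, iff_false]
        obtain ⟨x, hx, hxv⟩ : ∃ x ∈ B, x ≠ v := by
          by_contra! h
          exact hBz (Set.eq_singleton_iff_unique_mem.2 ⟨hz, h⟩)
        obtain ⟨y, hy⟩ := exists_adj_of_reachable_ne (hB x hx) hxv
        intro h
        have := h.unique ⟨.inl hr, hrz.symm⟩ ⟨.inr hy.2.2, hy.1⟩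
        exact hd hr (this ▸ hy.2.2)
    · have : ∀ w, ((w ∈ A ∨ w ∈ B) ∧ G.Adj v w) ↔ (w ∈ B ∧ G.Adj v w) := fun w =>
        ⟨fun ⟨h1, h2⟩ => ⟨h1.resolve_left fun h => hvz (hedge w h v hvB h2.symm).2, h2⟩,
          fun ⟨h1, h2⟩ => ⟨.inr h1, h2⟩⟩
      have hBz : B ≠ {z} := fun h => hvz (by rw [h] at hvB; exact hvB)
      simp [hvA, hvB, hvz, hvr, this, hBz]
  · have hvz : v ≠ z := fun h => hvB (h ▸ hz)
    simp [hvA, hvB, hvz]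

variable [Fintype V]

/-- Every tree, also if attached at its root to another graph, is described by a rooted tree with
the right numbers of edges and leaves. -/
theorem exists_rootedTree (G : SimpleGraph V) (S : Set V) (r : V) (hr : r ∈ S)
    (hac : (restr G S).IsAcyclic) (hconn : ∀ v ∈ S, (restr G S).Reachable r v) :
    ∃ T : RootedTree, T.edges + 1 = S.ncard ∧ T.leaves = (leafSet G S r).ncard ∧
      ∀ C : Set V, C ∩ S = {r} → (∀ i ∈ C, ∀ j ∈ S, G.Adj i j → i = r ∨ j = r) →
        ∀ t, 0 < t → ∀ c, Describes G C t r c → Describes G (C ∪ S) t r (c * T.network t) := by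
  induction hN : S.ncard using Nat.strong_induction_on generalizing S r with
  | _ N ih =>
  subst hN
  by_cases hS : S = {r}
  · refine ⟨.pt, by simp [hS, RootedTree.edges], ?_, fun C hC _ t ht c hc => ?_⟩
    · have : leafSet G S r = ∅ := by
        ext v
        simp only [leafSet, hS, Set.mem_ofPred_eq, Set.mem_singleton_iff, Set.mem_empty_iff_false,
          iff_false]
        tauto
      simp [this, RootedTree.leaves]
    · rw [hS, RootedTree.network, mul_one,
        Set.union_eq_left.2 (Set.singleton_subset_iff.2 hc.mem)]
      exact hc
  obtain ⟨x, hx, hxr⟩ : ∃ x ∈ S, x ≠ r := by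
    by_contra! h
    exact hS (Set.eq_singleton_iff_unique_mem.2 ⟨hr, h⟩)
  obtain ⟨z, hz⟩ := exists_adj_of_reachable_ne (hconn x hx) hxr
  obtain ⟨A, B, rfl, hAB, hrA, hzB, hedge, hA, hB⟩ := exists_split hr hac hconn hz.2.2 hz.1
  have hd := Set.disjoint_left.1 hAB
  have hcard := Set.ncard_union_eq hAB
  have hApos : 0 < A.ncard := (Set.ncard_pos).2 ⟨r, hrA⟩
  have hBpos : 0 < B.ncard := (Set.ncard_pos).2 ⟨z, hzB⟩
  have mono : ∀ {S' : Set V}, S' ⊆ A ∪ B → (restr G S').IsAcyclic := fun h =>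
    hac.anti (fun a b hab => ⟨hab.1, h hab.2.1, h hab.2.2⟩ : restr G _ ≤ restr G _)
  obtain ⟨a, ha1, ha2, ha3⟩ := ih _ (by omega) A r hrA (mono Set.subset_union_left) hA rfl
  obtain ⟨b, hb1, hb2, hb3⟩ := ih _ (by omega) B z hzB (mono Set.subset_union_right) hB rfl
  refine ⟨.join a b, by rw [hcard, RootedTree.edges]; omega, ?_, fun C hC hCS t ht c hc => ?_⟩
  · rw [RootedTree.leaves, leafSet_union hAB hrA hzB hz.1 hedge hB, Set.ncard_union_eq]
    · rw [ha2]
      congr 1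
      by_cases hBz : B = {z}
      · have : b.edges = 0 := by rw [hBz, Set.ncard_singleton] at hb1; omega
        simp [hBz, this]
      · have : b.edges ≠ 0 := by
          intro h
          rw [h] at hb1
          obtain ⟨y, rfl⟩ := Set.ncard_eq_one.1 hb1.symm
          exact hBz (by rw [Set.mem_singleton_iff.1 hzB])
        simp [hBz, this, hb2]
    · rw [Set.disjoint_left]
      intro v hv hv'
      refine hd hv.1 ?_
      rw [Set.mem_ofPred_eq] at hv'
      split_ifs at hv' with h
      · exact hv' ▸ hzB
      · exact hv'.1
  · have hCB : ∀ v ∈ C, v ∉ B := by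
      intro v hvC hvB
      have : v ∈ C ∩ (A ∪ B) := ⟨hvC, .inr hvB⟩
      rw [hC, Set.mem_singleton_iff] at this
      exact hd hrA (this ▸ hvB)
    have hCA : C ∩ A = {r} := by
      refine Set.eq_singleton_iff_unique_mem.2 ⟨⟨hc.mem, hrA⟩, fun v hv => ?_⟩
      have : v ∈ C ∩ (A ∪ B) := ⟨hv.1, .inl hv.2⟩
      rwa [hC] at this
    have h1 := ha3 C hCA (fun i hi j hj => hCS i hi j (.inl hj)) t ht c hc
    -- Taking the bare root `z` for `C` describes `B` by itself, ready to be joined to `C ∪ A` by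
    -- the edge `r z`.
    have h2 := hb3 {z} (by simpa using hzB) (by rintro i rfl; simp) t ht 1
      (describes_singleton G z)
    rw [one_mul, Set.union_eq_right.2 (Set.singleton_subset_iff.2 hzB)] at h2
    have h3 := h1.join ht h2 ?_ hz.1 ?_
    · rwa [Set.union_assoc, mul_assoc] at h3
    · rw [Set.disjoint_left]
      rintro v (hv | hv)
      · exact hCB v hv
      · exact hd hv
    · rintro i (hi | hi) j hj hij
      · rcases hCS i hi j (.inr hj) hij with rfl | rfl
        · exact hedge i hrA j hj hij
        · exact absurd hj (hd hrA)
      · exact hedge i hi j hj hij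

end Tree

/-! ### Unicyclic graphs -/

section Unicyclic
variable {V : Type*} [Fintype V] {G : SimpleGraph V}

/-- An edge of a cycle is not a bridge, so its deletion leaves a connected graph with one edge fewer
than vertices. -/
lemma IsUnicyclic.isTree_deleteEdges (hG : IsUnicyclic G) {u : V} {c : G.Walk u u}
    (hc : c.IsCycle) {e : Sym2 V} (he : e ∈ c.edges) : (G.deleteEdges {e}).IsTree := by
  induction e with | _ x y
  have hxy : s(x, y) ∈ G.edgeSet := c.edges_subset_edgeSet he
  have hnb : ¬ G.IsBridge s(x, y) := fun h => h.notMem_edges_of_isCycle hc he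
  rw [SimpleGraph.isTree_iff_connected_and_card]
  refine ⟨hG.1.connected_delete_edge_of_not_isBridge hnb, ?_⟩
  rw [SimpleGraph.edgeSet_deleteEdges, Nat.card_coe_set_eq, Nat.card_eq_fintype_card, ← hG.2]
  exact Set.ncard_sdiff_singleton_add_one hxy

/-- A cycle `d` avoiding an edge of `c` would survive in the tree obtained by deleting that edge. -/
lemma IsUnicyclic.edges_subset (hG : IsUnicyclic G) {u v : V} {c : G.Walk u u}
    (hc : c.IsCycle) {d : G.Walk v v} (hd : d.IsCycle) : c.edges ⊆ d.edges := by
  intro e he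
  by_contra hed
  refine (hG.isTree_deleteEdges hc he).isAcyclic (d.transfer _ fun e' he' => ?_)
    (hd.transfer _)
  rw [SimpleGraph.edgeSet_deleteEdges]
  exact ⟨d.edges_subset_edgeSet he', fun h => hed (h ▸ he')⟩

lemma IsUnicyclic.length_eq_egirth (hG : IsUnicyclic G) {u : V} {c : G.Walk u u}
    (hc : c.IsCycle) : (c.length : ℕ∞) = G.egirth := by
  refine le_antisymm ?_ (SimpleGraph.egirth_le_length hc)
  rw [SimpleGraph.le_egirth]
  intro v d hd
  have := (hc.isTrail.edges_nodup.subperm (hG.edges_subset hc hd)).length_le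
  rw [SimpleGraph.Walk.length_edges, SimpleGraph.Walk.length_edges] at this
  exact_mod_cast this

lemma isCycle_edges_iff {V : Type*} {G : SimpleGraph V} {u : V} {c : G.Walk u u} (hc : c.IsCycle) {m : ℕ} (hm : c.length = m + 1)
    (i j : Fin (m + 1)) : s(c.getVert i, c.getVert j) ∈ c.edges ↔
      (SimpleGraph.cycleGraph (m + 1)).Adj i j := by
  have hm2 : 2 ≤ m := by have := hc.three_le_length; omega
  have hinj : ∀ a b, a ≤ m → b ≤ m → c.getVert a = c.getVert b → a = b := fun a b ha hb h =>
    hc.getVert_injOn' (by simp [hm, ha]) (by simp [hm, hb]) h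
  have hlast : c.getVert (m + 1) = c.getVert 0 := by simp [← hm]
  have hi := i.isLt
  have hj := j.isLt
  rw [cycleGraph_adj_iff hm2, SimpleGraph.Walk.mk_mem_edges_iff_exists]
  constructor
  · rintro ⟨k, hk, h⟩
    rw [hm] at hk
    rw [Sym2.eq_iff] at h
    by_cases hkm : k = m
    · subst hkm
      rw [hlast] at h
      rcases h with ⟨h1, h2⟩ | ⟨h1, h2⟩
      · have := hinj _ _ (by omega) (by omega) h1
        have := hinj _ _ (by omega) (by omega) h2
        omega
      · have := hinj _ _ (by omega) (by omega) h1
        have := hinj _ _ (by omega) (by omega) h2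
        omega
    · rcases h with ⟨h1, h2⟩ | ⟨h1, h2⟩
      · have := hinj _ _ (by omega) (by omega) h1
        have := hinj _ _ (by omega) (by omega) h2
        omega
      · have := hinj _ _ (by omega) (by omega) h1
        have := hinj _ _ (by omega) (by omega) h2
        omega
  · rintro (h | h | ⟨h1, h2⟩ | ⟨h1, h2⟩)
    · exact ⟨i, by omega, by rw [h]⟩
    · exact ⟨j, by omega, by rw [h, Sym2.eq_swap]⟩
    · exact ⟨m, by omega, by rw [hlast, h1, h2, Sym2.eq_swap]⟩
    · exact ⟨m, by omega, by rw [hlast, h1, h2]⟩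

/-- A unicyclic graph with a single attached tree is described by its cycle and a rooted tree. -/
theorem SingleTreeClass.exists_rootedTree {n l g : ℕ} (hG : SingleTreeClass n l g G) :
    ∃ (m : ℕ) (T : RootedTree) (u : V), 2 ≤ m ∧ g = m + 1 ∧ T.edges + g = n ∧ T.leaves = l ∧
      ∀ t, 0 < t → ∀ c, Describes (SimpleGraph.cycleGraph (m + 1)) Set.univ t 0 c →
        Describes G Set.univ t u (c * T.network t) := by
  classical
  obtain ⟨u, c, hc, hsingle⟩ := hG.single_tree
  have hlen : c.length = g := by
    have := hG.unicyclic.length_eq_egirth hc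
    rw [hG.girth] at this
    exact_mod_cast this
  have h3 := hc.three_le_length
  obtain ⟨m, hm⟩ : ∃ m, g = m + 1 := ⟨g - 1, by omega⟩
  set H := G.deleteEdges {e | e ∈ c.edges} with hH
  set S : Set V := attachedTree G c u with hS
  set C : Set V := {v | v ∈ c.support} with hC
  have hSmem : ∀ v, v ∈ S ↔ H.Reachable u v := fun v => Iff.rfl
  have huS : u ∈ S := (hSmem u).2 (.refl _)
  have huC : u ∈ C := c.start_mem_support
  have hsub : ∀ w ∈ C, w ≠ u → ∀ x, H.Reachable w x → x = w := by
    intro w hw hwu x hx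
    obtain ⟨y, hy⟩ := Set.ncard_eq_one.1 (hsingle w hw hwu)
    have h1 : w ∈ attachedTree G c w := SimpleGraph.Reachable.refl _
    have h2 : x ∈ attachedTree G c w := hx
    rw [hy, Set.mem_singleton_iff] at h1 h2
    rw [h1, h2]
  -- Follow a walk from `u`: along a cycle edge start afresh at its end, along any other edge stay
  -- in the same attached tree.
  have hcover : ∀ v, ∃ w ∈ C, H.Reachable w v := by
    intro v
    have := hG.unicyclic.1.preconnected u v
    rw [SimpleGraph.reachable_iff_reflTransGen] at this
    induction this with
    | refl => exact ⟨u, huC, .refl _⟩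
    | @tail x y _ hxy ih =>
      obtain ⟨w, hw, hwx⟩ := ih
      by_cases he : s(x, y) ∈ c.edges
      · exact ⟨y, c.snd_mem_support_of_mem_edges he, .refl _⟩
      · refine ⟨w, hw, hwx.trans (SimpleGraph.Adj.reachable ?_)⟩
        rw [hH, SimpleGraph.deleteEdges_adj]
        exact ⟨hxy, he⟩
  have hSC : ∀ v, v ∈ C ∪ S := by
    intro v
    obtain ⟨w, hw, hwv⟩ := hcover v
    by_cases hwu : w = u
    · subst hwu
      exact .inr hwv
    · rw [hsub w hw hwu v hwv]
      exact .inl hw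
  have hinter : C ∩ S = {u} := by
    refine Set.eq_singleton_iff_unique_mem.2 ⟨⟨huC, huS⟩, fun v hv => ?_⟩
    by_contra hvu
    exact hvu (hsub v hv.1 hvu u (SimpleGraph.Reachable.symm hv.2)).symm
  have hedge : ∀ x y, G.Adj x y → s(x, y) ∈ c.edges ∨ (x ∈ S ∧ y ∈ S) := by
    intro x y hxy
    by_cases he : s(x, y) ∈ c.edges
    · exact .inl he
    right
    have hHxy : H.Adj x y := by
      rw [hH, SimpleGraph.deleteEdges_adj]
      exact ⟨hxy, he⟩
    obtain ⟨w, hw, hwx⟩ := hcover x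
    by_cases hwu : w = u
    · subst hwu
      exact ⟨hwx, hwx.trans hHxy.reachable⟩
    · have h1 := hsub w hw hwu x hwx
      have h2 := hsub w hw hwu y (hwx.trans hHxy.reachable)
      exact absurd (h1.trans h2.symm) hxy.ne
  have hedgeS : ∀ x ∈ S, ∀ y ∈ S, s(x, y) ∉ c.edges := by
    intro x hx y hy he
    have h1 : x ∈ C ∩ S := ⟨c.fst_mem_support_of_mem_edges he, hx⟩
    have h2 : y ∈ C ∩ S := ⟨c.snd_mem_support_of_mem_edges he, hy⟩
    rw [hinter, Set.mem_singleton_iff] at h1 h2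
    exact (c.adj_of_mem_edges he).ne (h1.trans h2.symm)
  have hconn : ∀ v ∈ S, (restr G S).Reachable u v := by
    intro v hv
    refine (reachable_restr hv).mono fun a b hab => ?_
    exact ⟨(SimpleGraph.deleteEdges_le _) hab.1, hab.2⟩
  have hac : (restr G S).IsAcyclic := by
    obtain ⟨e, he⟩ := List.exists_mem_of_ne_nil c.edges (by
      rw [← List.length_pos_iff_ne_nil, SimpleGraph.Walk.length_edges]; omega)
    refine (hG.unicyclic.isTree_deleteEdges hc he).isAcyclic.anti fun a b hab => ?_
    rw [SimpleGraph.deleteEdges_adj]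
    refine ⟨hab.1, fun h => hedgeS a hab.2.1 b hab.2.2 ?_⟩
    rw [Set.mem_singleton_iff.1 h]; exact he
  obtain ⟨T, hT1, hT2, hT3⟩ := UnicyclicLEL.exists_rootedTree G S u huS hac hconn
  set φ : Fin (m + 1) → V := fun i => c.getVert i with hφ
  have hφinj : Function.Injective φ := by
    intro i j hij
    ext
    exact hc.getVert_injOn' (by simp; omega) (by simp; omega) hij
  have hrange : Set.range φ = C := by
    ext v
    simp only [hC, Set.mem_ofPred_eq, SimpleGraph.Walk.mem_support_iff_exists_getVert, Set.mem_range,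
      hφ]
    constructor
    · rintro ⟨i, rfl⟩
      exact ⟨i, rfl, by omega⟩
    · rintro ⟨k, rfl, hk⟩
      by_cases hkm : k = m + 1
      · exact ⟨0, by simp [hkm, ← hm, ← hlen]⟩
      · exact ⟨⟨k, by omega⟩, rfl⟩
  have hφ0 : φ 0 = u := by simp [hφ]
  have hφadj : ∀ a b, G.Adj (φ a) (φ b) ↔ (SimpleGraph.cycleGraph (m + 1)).Adj a b := by
    intro a b
    rw [← isCycle_edges_iff hc (hlen.trans hm)]
    refine ⟨fun h => (hedge _ _ h).resolve_right fun ⟨h1, h2⟩ => ?_, c.adj_of_mem_edges⟩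
    have ha : φ a ∈ C ∩ S := ⟨hrange ▸ Set.mem_range_self a, h1⟩
    have hb : φ b ∈ C ∩ S := ⟨hrange ▸ Set.mem_range_self b, h2⟩
    rw [hinter, Set.mem_singleton_iff] at ha hb
    exact h.ne (ha.trans hb.symm)
  have hCcard : C.ncard = g := by
    rw [← hrange, ← Set.image_univ, Set.ncard_image_of_injective _ hφinj, Set.ncard_univ, hm]
    simp
  have huniv : C ∪ S = Set.univ := Set.eq_univ_of_forall hSC
  refine ⟨m, T, u, by omega, hm, ?_, ?_, fun t ht c' hc' => ?_⟩
  · have h1 := Set.ncard_union_add_ncard_inter C S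
    rw [huniv, hinter, Set.ncard_univ, Nat.card_eq_fintype_card, hG.order, Set.ncard_singleton,
      hCcard] at h1
    omega
  · rw [hT2, ← hG.leaves, numLeaves, ← Set.ncard_coe_finset]
    congr 1
    ext v
    simp only [leafSet, Set.mem_ofPred_eq, Finset.coe_filter, Finset.mem_univ, true_and]
    rw [SimpleGraph.degree_eq_one_iff_existsUnique_adj]
    by_cases hvC : v ∈ C
    · have h1 : ¬ (v ∈ S ∧ v ≠ u) := by
        rintro ⟨h1, h2⟩
        have : v ∈ C ∩ S := ⟨hvC, h1⟩
        rw [hinter] at this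
        exact h2 this
      -- No leaf of `G` lies on the cycle, since cycle vertices have two cycle neighbours; positions
      -- 0 and `m` wrap around.
      have h2 : ¬ ∃! w, G.Adj v w := by
        intro h
        obtain ⟨i, hi⟩ : ∃ i, φ i = v := by rw [← hrange] at hvC; exact hvC
        have h3 : ∀ j j' : Fin (m + 1), (SimpleGraph.cycleGraph (m + 1)).Adj i j →
            (SimpleGraph.cycleGraph (m + 1)).Adj i j' → j = j' := by
          intro j j' hj hj'
          rw [← hφadj, hi] at hj hj'
          exact hφinj (h.unique hj hj')
        have hm2 : 2 ≤ m := by omega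
        simp only [cycleGraph_adj_iff hm2, Fin.ext_iff] at h3
        by_cases hi0 : i.val = 0
        · have := h3 ⟨1, by omega⟩ ⟨m, by omega⟩ (by dsimp only; omega) (by dsimp only; omega)
          dsimp only at this; omega
        · by_cases him : i.val = m
          · have := h3 ⟨0, by omega⟩ ⟨m - 1, by omega⟩ (by dsimp only; omega) (by dsimp only; omega)
            dsimp only at this; omega
          · have := h3 ⟨i - 1, by omega⟩ ⟨i + 1, by omega⟩ (by dsimp only; omega) (by dsimp only; omega)
            dsimp only at this; omega
      tauto
    · have hvS : v ∈ S := (hSC v).resolve_left hvC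
      have hvu : v ≠ u := fun h => hvC (h ▸ huC)
      have : ∀ w, (w ∈ S ∧ G.Adj v w) ↔ G.Adj v w := fun w =>
        ⟨fun h => h.2, fun h => ⟨((hedge v w h).resolve_left fun he =>
          hvC (c.fst_mem_support_of_mem_edges he)).2, h⟩⟩
      simp [hvS, hvu, this]
  · rw [← huniv]
    refine hT3 C hinter (fun i hi j hj hij => ?_) t ht c' ?_
    · rcases hedge i j hij with he | ⟨hi', -⟩
      · right
        have : j ∈ C ∩ S := ⟨c.snd_mem_support_of_mem_edges he, hj⟩
        rwa [hinter] at this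
      · left
        have : i ∈ C ∩ S := ⟨hi, hi'⟩
        rwa [hinter] at this
    · have := hc'.map φ hφinj hφadj
      rwa [hrange, hφ0] at this

end Unicyclic
end UnicyclicLEL

namespace UnicyclicLEL

/-! ### The balanced starlike unicyclic graphs -/

section Balanced
variable {n l g q : ℕ}

open BalVertex

lemma bal_adj_cyc_cyc (i i' : Fin g) :
    (balancedStarlikeUnicyclic n l g q).Adj (cyc i) (cyc i') ↔
      (SimpleGraph.cycleGraph g).Adj i i' := by
  simp only [balancedStarlikeUnicyclic, SimpleGraph.fromRel_adj, balRel, ne_eq, cyc.injEq]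
  exact ⟨fun h => h.2.elim id SimpleGraph.Adj.symm, fun h => ⟨h.ne, .inl h⟩⟩

lemma bal_adj_path_cyc (j : Fin q) (i : Fin g) :
    (balancedStarlikeUnicyclic n l g q).Adj (path j) (cyc i) ↔ i.val = 0 ∧ j.val = 0 := by
  simp [balancedStarlikeUnicyclic, balRel]

lemma bal_adj_path_path (j j' : Fin q) :
    (balancedStarlikeUnicyclic n l g q).Adj (path j) (path j') ↔
      j.val + 1 = j'.val ∨ j'.val + 1 = j.val := by
  simp only [balancedStarlikeUnicyclic, SimpleGraph.fromRel_adj, balRel, ne_eq, path.injEq,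
    Fin.ext_iff]
  omega

lemma bal_adj_cyc_leg (i : Fin g) (a : Fin l) (k : Fin (legLength (n - g - q) l a)) :
    (balancedStarlikeUnicyclic n l g q).Adj (cyc i) (leg a k) ↔
      q = 0 ∧ i.val = 0 ∧ k.val = 0 := by
  simp [balancedStarlikeUnicyclic, balRel]

lemma bal_adj_path_leg (j : Fin q) (a : Fin l) (k : Fin (legLength (n - g - q) l a)) :
    (balancedStarlikeUnicyclic n l g q).Adj (path j) (leg a k) ↔
      j.val + 1 = q ∧ k.val = 0 := by
  simp [balancedStarlikeUnicyclic, balRel]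

lemma bal_adj_leg_leg (a a' : Fin l) (k : Fin (legLength (n - g - q) l a))
    (k' : Fin (legLength (n - g - q) l a')) :
    (balancedStarlikeUnicyclic n l g q).Adj (leg a k) (leg a' k') ↔
      a = a' ∧ (k.val + 1 = k'.val ∨ k'.val + 1 = k.val) := by
  simp only [balancedStarlikeUnicyclic, SimpleGraph.fromRel_adj, balRel, ne_eq, leg.injEq]
  constructor
  · rintro ⟨-, ⟨rfl, h⟩ | ⟨rfl, h⟩⟩
    · exact ⟨rfl, .inl h⟩
    · exact ⟨rfl, .inr h⟩
  · rintro ⟨rfl, h⟩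
    refine ⟨fun h' => ?_, h.imp (⟨rfl, ·⟩) (⟨rfl, ·⟩)⟩
    have := eq_of_heq h'.2
    subst this
    omega

/-- The `j`-th vertex of the path from the cycle to the centre. -/
def spine (n l m q : ℕ) (j : ℕ) : BalVertex n l (m + 1) q :=
  if h : 0 < j ∧ j - 1 < q then path ⟨j - 1, h.2⟩ else cyc 0

lemma spine_zero (m : ℕ) : spine n l m q 0 = cyc 0 := by simp [spine]

lemma spine_succ (m : ℕ) {j : ℕ} (h : j < q) : spine n l m q (j + 1) = path ⟨j, h⟩ := by
  simp [spine, h]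

/-- The vertices of the legs with indices in `s`. -/
def legSet (n l g q : ℕ) (s : Finset (Fin l)) : Set (BalVertex n l g q) :=
  {v | ∃ a ∈ s, ∃ k, v = leg a k}

lemma describes_core {m : ℕ} {t : ℝ} (ht : 0 < t) {c : DualNumber ℝ}
    (hc : Describes (SimpleGraph.cycleGraph (m + 1)) Set.univ t 0 c) :
    Describes (balancedStarlikeUnicyclic n l (m + 1) q) (legSet n l (m + 1) q Finset.univ)ᶜ t
      (spine n l m q q) ((up t)^[q] c) := by
  have hcyc := hc.map (H := balancedStarlikeUnicyclic n l (m + 1) q) cyc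
    (fun _ _ h => by simpa using h) bal_adj_cyc_cyc
  rw [← spine_zero] at hcyc
  have h := hcyc.chain ht (spine n l m q) q ?_ ?_ ?_ ?_ ?_
  · convert h using 1
    ext v
    simp only [legSet, Set.mem_compl_iff, Set.mem_union, Set.mem_ofPred_eq, Finset.mem_univ,
      true_and, Set.mem_range]
    rcases v with i | j | ⟨a, k⟩
    · simp
    · refine iff_of_true (by simp) (.inr ⟨j, j.isLt, ?_⟩)
      rw [spine_succ _ j.isLt]
    · refine iff_of_false (fun h => h ⟨a, k, rfl⟩) ?_
      rintro (⟨_, h⟩ | ⟨i, hi, h⟩)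
      · simp at h
      · rw [spine_succ _ hi] at h
        simp at h
  · intro i hi
    rw [spine_succ _ hi]
    simp
  · intro i j hj hi
    obtain ⟨i, rfl⟩ : ∃ i', i = i' + 1 := ⟨i - 1, by omega⟩
    rw [spine_succ _ (by omega : i < q)]
    rcases j with _ | j
    · rw [spine_zero]; simp
    · rw [spine_succ _ (by omega : j < q)]
      simp; omega
  · intro i hi
    rw [spine_succ _ hi, SimpleGraph.adj_comm]
    rcases i with _ | i
    · rw [spine_zero, bal_adj_path_cyc]; simp
    · rw [spine_succ _ (by omega : i < q), bal_adj_path_path]; simp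
  · rintro i hi _ ⟨x, rfl⟩ h
    rw [spine_succ _ hi, bal_adj_path_cyc] at h
    obtain ⟨h1, h2⟩ := h
    dsimp only at h2
    subst h2
    rw [spine_zero, Fin.ext (a := x) (b := 0) h1]
  · intro i j hj hi h
    rcases j with _ | j
    · rw [spine_zero, spine_succ _ hi, bal_adj_path_cyc] at h
      rw [show i = 0 from h.2]
    · rw [spine_succ _ hi, spine_succ _ (by omega : j < q), bal_adj_path_path] at h
      rw [show i = j + 1 by dsimp only at h; omega]

lemma describes_leg {t : ℝ} (ht : 0 < t) (a : Fin l) (hL : 0 < legLength (n - g - q) l a) :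
    Describes (balancedStarlikeUnicyclic n l g q) (legSet n l g q {a}) t
      (leg a ⟨0, hL⟩) (pathNet t (legLength (n - g - q) l a - 1)) := by
  set L := legLength (n - g - q) l a with hLdef
  -- The leg is built from its free end towards the centre. It has `L - 1` inner edges; the edge to
  -- the centre is added when the leg is joined.
  set w : ℕ → BalVertex n l g q := fun j => leg a ⟨L - 1 - j, by omega⟩ with hw
  have h := (describes_singleton (balancedStarlikeUnicyclic n l g q) (t := t) (w 0)).chain ht w
    (L - 1) ?_ ?_ ?_ ?_ ?_
  · convert h using 1
    · ext v
      simp only [legSet, Finset.mem_singleton, exists_eq_left, Set.mem_ofPred_eq, Set.mem_union,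
        Set.mem_singleton_iff]
      constructor
      · rintro ⟨k, rfl⟩
        have hk := k.isLt
        by_cases hkL : k.val = L - 1
        · left
          simp [hw, Fin.ext_iff, hkL]
        · right
          refine ⟨L - 2 - k, by omega, ?_⟩
          simp only [hw, leg.injEq, heq_eq_eq, true_and, Fin.ext_iff]
          omega
      · rintro (rfl | ⟨i, hi, rfl⟩)
        · exact ⟨_, rfl⟩
        · exact ⟨_, rfl⟩
    · simp [hw]
    · rfl
  · intro i hi
    simp only [hw, Set.mem_singleton_iff, leg.injEq, heq_eq_eq, true_and, Fin.ext_iff]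
    omega
  · intro i j hj hi
    simp only [hw, ne_eq, leg.injEq, heq_eq_eq, true_and, Fin.ext_iff]
    omega
  · intro i hi
    simp only [hw, bal_adj_leg_leg, true_and]
    omega
  · rintro i hi _ rfl
    simp only [hw, bal_adj_leg_leg, true_and, leg.injEq, heq_eq_eq, Fin.ext_iff]
    omega
  · intro i j hj hi
    simp only [hw, bal_adj_leg_leg, true_and, leg.injEq, heq_eq_eq, Fin.ext_iff]
    omega

/-- The network of the balanced starlike unicyclic graph. -/
theorem describes_balanced {m : ℕ} {t : ℝ} (ht : 0 < t) {c : DualNumber ℝ}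
    (hc : Describes (SimpleGraph.cycleGraph (m + 1)) Set.univ t 0 c)
    (hL : ∀ a : Fin l, 0 < legLength (n - (m + 1) - q) l a) :
    Describes (balancedStarlikeUnicyclic n l (m + 1) q) Set.univ t (spine n l m q q)
      ((up t)^[q] c * star t (balancedLegs (n - (m + 1) - q) l)) := by
  classical
  have key : ∀ s : Finset (Fin l), Describes (balancedStarlikeUnicyclic n l (m + 1) q)
      ((legSet n l (m + 1) q Finset.univ)ᶜ ∪ legSet n l (m + 1) q s) t (spine n l m q q)
      ((up t)^[q] c * star t (s.val.map (legLength (n - (m + 1) - q) l))) := by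
    intro s
    induction s using Finset.induction_on with
    | empty =>
      have : legSet n l (m + 1) q ∅ = ∅ := by simp [legSet]
      rw [this]
      simpa using describes_core ht hc
    | insert a s ha ih =>
      have h := ih.join ht (describes_leg ht a (hL a)) ?_ ?_ ?_
      · rw [← pathNet_succ, Nat.sub_add_cancel (hL a), mul_assoc, mul_comm (star t _), ← star_cons,
          ← Multiset.map_cons, ← Finset.insert_val_of_notMem ha] at h
        convert h using 1
        rw [Set.union_assoc]
        congr 1
        ext v
        simp only [legSet, Finset.mem_insert, Set.mem_ofPred_eq, Finset.mem_singleton,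
          exists_eq_left, Set.mem_union, or_and_right, exists_or]
        exact or_comm
      · rw [Set.disjoint_left]
        rintro v (hv | ⟨b, hb, k, rfl⟩) ⟨a', ha', k', hv'⟩
        · exact hv ⟨a', Finset.mem_univ _, k', hv'⟩
        · rw [Finset.mem_singleton] at ha'
          simp only [leg.injEq] at hv'
          exact ha (by rw [← ha', ← hv'.1]; exact hb)
      · rcases q with _ | q
        · rw [spine_zero, bal_adj_cyc_leg]; simp
        · rw [spine_succ m (Nat.lt_succ_self q), bal_adj_path_leg]; simp
      · rintro v (hv | ⟨b, hb, k, rfl⟩) _ ⟨a', ha', k', rfl⟩ hvk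
        · rw [Finset.mem_singleton] at ha'
          subst ha'
          rcases v with i | j | ⟨a, k⟩
          · rw [bal_adj_cyc_leg] at hvk
            obtain ⟨h1, h2, h3⟩ := hvk
            subst h1
            rw [spine_zero, Fin.ext (a := k') (b := ⟨0, hL a'⟩) h3,
              Fin.ext (a := i) (b := 0) h2]
            exact ⟨rfl, rfl⟩
          · rw [bal_adj_path_leg] at hvk
            obtain ⟨h1, h3⟩ := hvk
            rw [Fin.ext (a := k') (b := ⟨0, hL a'⟩) h3]
            refine ⟨?_, rfl⟩
            have := spine_succ (n := n) (l := l) m j.isLt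
            rw [h1] at this
            exact this.symm
          · exact absurd ⟨a, Finset.mem_univ _, k, rfl⟩ hv
        · rw [bal_adj_leg_leg] at hvk
          rw [Finset.mem_singleton] at ha'
          exact absurd (ha' ▸ hvk.1 ▸ hb) ha
  have := key Finset.univ
  rwa [Set.compl_union_self] at this

lemma card_balVertex (h : g + q ≤ n) (hl : l = 0 → n = g + q) :
    Fintype.card (BalVertex n l g q) = n := by
  rw [Fintype.card_congr (BalVertex.equivSum n l g q)]
  simp only [Fintype.card_sum, Fintype.card_fin, Fintype.card_sigma]
  have : ∑ a : Fin l, legLength (n - g - q) l a = n - g - q := by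
    rcases Nat.eq_zero_or_pos l with rfl | hpos
    · simp; have := hl rfl; omega
    · exact sum_balancedLegs hpos
  omega

end Balanced

/-! ### The theorem -/

open Classical in
lemma Describes.det_zero {V : Type*} [Fintype V] {G : SimpleGraph V} {S : Set V} {t : ℝ} {r : V}
    {c : DualNumber ℝ} (h : Describes G S t r c) : (grounded G S t r 0).det = gdet t c := by
  rw [h.det_eq 0 le_rfl, gdet]; ring

/-- The hypothesis rearranges to q (l + 1) ≤ n - g - gl + l. The right side may be negative in
general; `toNat` then supplies the maximum with 0. -/
lemma le_maxPathLength {n l g q : ℕ} (h : l * (q + (g - 1)) + q + g ≤ n) (hg : 1 ≤ g) :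
    q ≤ maxPathLength n l g := by
  rw [maxPathLength, ← Int.toNat_natCast q]
  refine Int.toNat_le_toNat (Int.le_floor.2 ?_)
  rw [le_div_iff₀ (by positivity)]
  obtain ⟨k, rfl⟩ := Nat.exists_eq_add_of_le' hg
  rw [Nat.add_sub_cancel] at h
  have : ((l * (q + k) + q + (k + 1) : ℕ) : ℚ) ≤ n := by exact_mod_cast h
  push_cast at this ⊢
  linarith

end UnicyclicLEL

theorem corollary3p5 {V : Type*} [Fintype V] (n l g : ℕ) (G : SimpleGraph V)
    (hG : UnicyclicLEL.SingleTreeClass n l g G) :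
    (Finset.range (UnicyclicLEL.maxPathLength n l g + 1)).inf' Finset.nonempty_range_add_one
        (fun q => UnicyclicLEL.LEL (UnicyclicLEL.balancedStarlikeUnicyclic n l g q))
      ≤ UnicyclicLEL.LEL G := by
  open UnicyclicLEL in
  obtain ⟨m, T, u, hm, rfl, hn, hl, hT⟩ := hG.exists_rootedTree
  obtain ⟨q, s, hs, hsl, hsum, hdom⟩ := T.dominates
  -- The network of the cycle depends on `t`; quantifying over all real `t` allows `choose` to make
  -- it a function, with the value 0 where `t` is not positive.
  have hcyc : ∀ t : ℝ, ∃ c, 0 < t →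
      Describes (SimpleGraph.cycleGraph (m + 1)) Set.univ t 0 c ∧ 0 ≤ cross c (pathNet t m) := by
    intro t
    by_cases ht : 0 < t
    · obtain ⟨c, hc⟩ := exists_describes_cycleGraph ht hm
      exact ⟨c, fun _ => hc⟩
    · exact ⟨0, fun h => absurd h ht⟩
  choose c hc using hcyc
  have hcn : ∀ t, 0 < t → Nonneg (c t) := fun t ht => ⟨(hc t ht).1.pos.le, (hc t ht).1.nonneg⟩
  obtain ⟨q', h1, h2, h3, h4⟩ := exists_short_broom m q s hs hcn fun t ht => (hc t ht).2
  rw [hsl, hl, hsum] at h1 h2 h4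
  rw [hsl, hl] at h3
  have hN : T.edges - q' = n - (m + 1) - q' := by omega
  rw [hN] at h4
  -- At least `l` vertices remain for the `l` legs, so even the rounded-down length is positive.
  have hL : ∀ a : Fin l, 0 < legLength (n - (m + 1) - q') l a := by
    intro a
    have := Nat.div_pos (show l ≤ n - (m + 1) - q' by omega) a.pos
    rw [legLength]; omega
  have hq' : q' ∈ Finset.range (maxPathLength n l (m + 1) + 1) := by
    rw [Finset.mem_range, Nat.lt_succ_iff]
    rcases h2 with rfl | h2
    · exact Nat.zero_le _
    · exact le_maxPathLength (by rw [Nat.add_sub_cancel]; omega) (by omega)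
  refine (Finset.inf'_le _ hq').trans (LEL_le ?_ (r := spine n l m q' q') (s := u) ?_)
  · rw [card_balVertex (by omega), hG.order]
    -- Without leaves the attached tree has no edge, hence n = g and the path is empty.
    intro h0
    have hs0 : s = 0 := Multiset.card_eq_zero.1 (by omega)
    have := hs.2 hs0
    subst hs0
    simp at hsum
    omega
  · intro t ht
    rw [(describes_balanced ht (hc t ht).1 hL).det_zero, (hT t ht _ (hc t ht).1).det_zero]
    -- The balanced graph was described from its centre; the remaining equality re-roots it at the
    -- cycle vertex, where the comparisons are made.
    refine le_trans (le_trans (le_of_eq ?_) (h4 t ht)) ((hdom t ht).mul_left (hcn t ht)).2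
    rw [gdet_iterate_up_mul, broom]
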